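/- Let $\alpha,a,b,c$ be real numbers with $\alpha>-1$, $-a,-b,-c\notin\mathbb{N}_0=\{0,1,2,\dots\}$ and $c-a-b+(\alpha+1)/2>0$. Write $(x)_n=x(x+1)\cdots(x+n-1)$ for the Pochhammer symbol, ${}_2F_1(a,b;c;x)=\sum_{n\ge0}\frac{(a)_n(b)_n}{(c)_n\,n!}x^n$ for the Gaussian hypergeometric series, and $$L_n^{(\alpha)}(z)=\frac{(\alpha+1)_n}{n!}\sum_{k=0}^{n}\frac{(-n)_k}{(\alpha+1)_k\,k!}\,z^k$$ for the generalized Laguerre polynomials. Then the following hold. (i) The Laguerre series $${}_2\mathcal{H}_1^{(\alpha)}(a,b;c;z)=\sum_{n=0}^{\infty}(-1)^n\frac{(a)_n(b)_n}{(c)_n(\alpha+1)_n}\,L_n^{(\alpha)}(z)$$ converges in the norm of the weighted Hilbert space $L^2([0,\infty),x^{\alpha}e^{-x}\,dx)$ and so defines, up to almost everywhere equality, a function ${}_2\mathcal{H}_1^{(\alpha)}(a,b;c;\cdot)$ on $[0,\infty)$. (ii) For all sufficiently large $\nu\in\mathbb{N}_0$ the series ${}_2F_1(a+\nu,b+\nu;c+\nu;-1)$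 diverges. For every $\nu\in\mathbb{N}_0$ the function $\zeta\mapsto{}_2F_1(a+\nu,b+\nu;c+\nu;\zeta)$, $|\zeta|<1$, has an analytic continuation to the half-plane $\operatorname{Re}\zeta<1/2$ (that is, there is an analytic function on this half-plane that coincides with it where both are defined), and the value of the continuation at $\zeta=-1$ is $$2^{-a-\nu}\,{}_2F_1(a+\nu,c-b;c+\nu;1/2)=2^{-b-\nu}\,{}_2F_1(c-a,b+\nu;c+\nu;1/2),$$ where both series on this line converge. (iii) The two power series $$2^{-a}\sum_{\nu=0}^{\infty}{}_2F_1(a+\nu,c-b;c+\nu;1/2)\,\frac{(a)_\nu(b)_\nu}{(c)_\nu\,\nu!}\,\frac{(z/2)^\nu}{(\alpha+1)_\nu},\qquad 2^{-b}\sum_{\nu=0}^{\infty}{}_2F_1(c-a,b+\nu;c+\nu;1/2)\,\frac{(a)_\nu(b)_\nu}{(c)_\nu\,\nu!}\,\frac{(z/2)^\nu}{(\alpha+1)_\nu}$$ converge absolutely for every $z\in\mathbb{C}$ and have the same sum $F(z)$, the function $F$ is entire (in particular analytic at the origin), and ${}_2\mathcal{H}_1^{(\alpha)}(a,b;c;x)=F(x)$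 for almost every $x\in[0,\infty)$. Thus both power series represent the function defined by the Laguerre series, which is analytic in every neighbourhood of the origin. -/

import Mathlib

open Filter Topology MeasureTheory
open scoped Nat

/-- The Pochhammer symbol `(x)_n = x (x + 1) ⋯ (x + n - 1)` of a real number `x`. -/
noncomputable def poch (x : ℝ) (n : ℕ) : ℝ :=
  (ascPochhammer ℝ n).eval x

/-- The generalized Laguerre polynomial
`L_n^{(α)}(z) = (α+1)_n / n! · ₁F₁(-n; α+1; z)`, as a function of `z : ℂ`;
the terminating series `₁F₁(-n; α+1; z)` is written out as a finite sum. -/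
noncomputable def laguerreL (α : ℝ) (n : ℕ) (z : ℂ) : ℂ :=
  ((poch (α + 1) n / (n ! : ℝ) : ℝ) : ℂ) *
    ∑ k ∈ Finset.range (n + 1),
      ((poch (-(n : ℝ)) k / (poch (α + 1) k * (k ! : ℝ)) : ℝ) : ℂ) * z ^ k

/-- The measure `x^α e^{-x} dx` on `[0, ∞)`. -/
noncomputable def laguerreMeasure (α : ℝ) : Measure ℝ :=
  (volume.restrict (Set.Ici (0 : ℝ))).withDensity
    (fun x => ENNReal.ofReal (x ^ α * Real.exp (-x)))

/-- `f` is the sum of the Laguerre series `∑ lam n • L_n^{(α)}` in the weighted Hilbert space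
`L²([0, ∞), x^α e^{-x} dx)`: `f` belongs to that space and the partial sums of the series
converge to `f` in its norm. It determines `f` up to almost everywhere equality on `[0, ∞)`. -/
def IsLaguerreSum (α : ℝ) (lam : ℕ → ℝ) (f : ℝ → ℂ) : Prop :=
  MemLp f 2 (laguerreMeasure α) ∧
    Tendsto
      (fun N : ℕ => eLpNorm
        (fun x : ℝ => f x - ∑ n ∈ Finset.range N, (lam n : ℂ) * laguerreL α n (x : ℂ))
        2 (laguerreMeasure α))
      atTop (𝓝 0)

/-- The coefficients `(-1)^n (a)_n (b)_n / ((c)_n (α+1)_n)` of the Laguerre series `₂𝓗₁^{(α)}`. -/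
noncomputable def twoHOneCoeff (α a b c : ℝ) (n : ℕ) : ℝ :=
  (-1) ^ n * (poch a n * poch b n / (poch c n * poch (α + 1) n))

/-- `f` is (a representative of) the function `₂𝓗₁^{(α)}(a, b; c; ·)`, the sum of the series
`∑ (-1)^n (a)_n (b)_n / ((c)_n (α+1)_n) L_n^{(α)}` in `L²([0, ∞), x^α e^{-x} dx)`. -/
def IsTwoHOne (α a b c : ℝ) (f : ℝ → ℂ) : Prop :=
  IsLaguerreSum α (twoHOneCoeff α a b c) f

/-- The term
`₂F₁(a+ν, c-b; c+ν; 1/2) · (a)_ν (b)_ν / ((c)_ν ν!) · (z/2)^ν / (α+1)_ν`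
of the first power series. -/
noncomputable def powerTermFst (α a b c : ℝ) (z : ℂ) (ν : ℕ) : ℂ :=
  ((₂F₁ (a + ν) (c - b) (c + ν) (1 / 2 : ℝ) *
      (poch a ν * poch b ν / (poch c ν * (ν ! : ℝ))) : ℝ) : ℂ) *
    ((z / 2) ^ ν / ((poch (α + 1) ν : ℝ) : ℂ))

/-- The term
`₂F₁(c-a, b+ν; c+ν; 1/2) · (a)_ν (b)_ν / ((c)_ν ν!) · (z/2)^ν / (α+1)_ν`
of the second power series. -/
noncomputable def powerTermSnd (α a b c : ℝ) (z : ℂ) (ν : ℕ) : ℂ :=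
  ((₂F₁ (c - a) (b + ν) (c + ν) (1 / 2 : ℝ) *
      (poch a ν * poch b ν / (poch c ν * (ν ! : ℝ))) : ℝ) : ℂ) *
    ((z / 2) ^ ν / ((poch (α + 1) ν : ℝ) : ℂ))

/-- The `n`-th term `(a)_n (b)_n / ((c)_n n!) · x^n` of the Gaussian hypergeometric series
`₂F₁(a, b; c; x)`. -/
noncomputable def gaussTerm (a b c x : ℝ) (n : ℕ) : ℝ :=
  poch a n * poch b n / (poch c n * (n ! : ℝ)) * x ^ n

/-- `s` is the value at `-1` of the analytic continuation of the Gaussian hypergeometric function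
`₂F₁(a, b; c; ·)` from the open unit disc to the half-plane `Re ζ < 1/2`, which contains `-1`. -/
def IsContinuedGaussAtNegOne (a b c : ℝ) (s : ℝ) : Prop :=
  ∃ G : ℂ → ℂ,
    AnalyticOnNhd ℂ G {ζ : ℂ | ζ.re < 1 / 2} ∧
    (∀ ζ : ℂ, ‖ζ‖ < 1 → ζ.re < 1 / 2 → G ζ = ₂F₁ a b c ζ) ∧
    G (-1) = (s : ℂ)

/-! The Laguerre series is regularised by Abel summation. With factors `r ^ n`, `0 ≤ r < 1`, it may
be rearranged absolutely into powers of `z`; the coefficient of `(r z)^k` then contains `₂F₁(a+k,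
b+k; c+k; -r)`. Pfaff's transformation turns this into `(1+r)^(-a-k) ₂F₁(a+k, c-b; c+k; r/(1+r))`.
The new argument stays in `[0, 1/2]`, so dominated convergence allows `r → 1`, although the
untransformed series at `-1` diverge for large `k`. The pointwise Abel limit is the entire function
`twoHOne` (`hasSum_abel_laguerre`, `tendsto_abel_laguerre`).

To identify this limit with the `L²` sum, Gamma asymptotics give summable squared norms
(`summable_twoHOneCoeff_sq`), Parseval bounds the distance between partial sums and Abel means, and
Fatou carries the bound to the limit (`eLpNorm_twoHOne_sub_le`). Hence `twoHOne` itself is the `L²`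
limit, without appeal to completeness.

Pfaff's formula holds near `0` by the binomial series and Chu–Vandermonde, and spreads by the
identity theorem. Its right side is the continuation to `Re ζ < 1/2`; symmetry in `a, b` equates the
two replacing series. -/

section Pochhammer

/-! ### Pochhammer symbols -/

@[simp] lemma poch_zero (x : ℝ) : poch x 0 = 1 := by simp [poch]

lemma poch_succ (x : ℝ) (n : ℕ) : poch x (n + 1) = poch x n * (x + n) := by
  simp [poch, ascPochhammer_succ_eval]

lemma poch_add (x : ℝ) (m n : ℕ) : poch x (m + n) = poch x m * poch (x + m) n := by
  induction n with
  | zero => simp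
  | succ n ih =>
    rw [← add_assoc, poch_succ, ih, poch_succ]
    push_cast
    ring

lemma poch_succ_left (x : ℝ) (n : ℕ) : poch x (n + 1) = x * poch (x + 1) n := by
  rw [add_comm n 1, poch_add, poch_succ]
  simp

lemma poch_ne_zero {x : ℝ} (hx : ∀ m : ℕ, x ≠ -(m : ℝ)) (n : ℕ) : poch x n ≠ 0 := by
  induction n with
  | zero => simp
  | succ n ih =>
    rw [poch_succ]
    exact mul_ne_zero ih fun h => hx n (by linarith)

lemma poch_pos {x : ℝ} (hx : 0 < x) (n : ℕ) : 0 < poch x n := ascPochhammer_pos n x hx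

lemma poch_one (n : ℕ) : poch 1 n = (n ! : ℝ) := by
  induction n with
  | zero => simp
  | succ n ih => rw [poch_succ, ih, Nat.factorial_succ]; push_cast; ring

lemma add_natCast_ne_neg_natCast {x : ℝ} (hx : ∀ m : ℕ, x ≠ -(m : ℝ)) (k m : ℕ) :
    x + k ≠ -(m : ℝ) := fun h => hx (m + k) (by push_cast; linarith)

lemma ne_neg_natCast_of_pos {x : ℝ} (hx : 0 < x) (m : ℕ) : x ≠ -(m : ℝ) := by
  have : (0 : ℝ) ≤ m := m.cast_nonneg
  intro h
  linarith

lemma poch_neg_natCast (n k : ℕ) :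
    poch (-(n : ℝ)) k = (-1) ^ k * (k ! : ℝ) * (n.choose k : ℝ) := by
  induction k with
  | zero => simp
  | succ k ih =>
    rw [poch_succ, ih]
    rcases le_or_gt k n with h | h
    · have h1 := Nat.choose_succ_right_eq n k
      have h2 : (n.choose (k + 1) : ℝ) * (k + 1) = n.choose k * ((n : ℝ) - k) := by
        rw [← Nat.cast_sub h]
        exact_mod_cast h1
      rw [Nat.factorial_succ, pow_succ]
      push_cast
      linear_combination (-(-1) ^ k * (k ! : ℝ)) * (-h2)
    · rw [Nat.choose_eq_zero_of_lt h, Nat.choose_eq_zero_of_lt (by omega)]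
      simp

lemma tendsto_add_natCast_div (a c : ℝ) :
    Tendsto (fun n : ℕ => (a + n) / (c + n)) atTop (𝓝 1) := by
  have h : Tendsto (fun n : ℕ => 1 + (a - c) / (c + n)) atTop (𝓝 (1 + 0)) :=
    tendsto_const_nhds.add (tendsto_const_nhds.div_atTop
      (tendsto_atTop_add_const_left _ _ tendsto_natCast_atTop_atTop))
  rw [add_zero] at h
  refine h.congr' ?_
  filter_upwards [(tendsto_atTop_add_const_left _ c
    tendsto_natCast_atTop_atTop).eventually_gt_atTop 0] with n hn
  field_simp
  ring

/-- Quotients of Pochhammer symbols grow more slowly than any geometric sequence of ratio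
greater than one. -/
lemma exists_abs_poch_le (a : ℝ) {c ρ : ℝ} (hc : ∀ m : ℕ, c ≠ -(m : ℝ)) (hρ : 1 < ρ) :
    ∃ C : ℝ, 0 < C ∧ ∀ n, |poch a n| ≤ C * ρ ^ n * |poch c n| := by
  have hlim := (tendsto_add_natCast_div a c).abs
  rw [abs_one] at hlim
  obtain ⟨N, hN⟩ := eventually_atTop.1 (hlim.eventually (gt_mem_nhds hρ))
  have hcpos : ∀ n, 0 < |poch c n| := fun n => abs_pos.2 (poch_ne_zero hc n)
  have hρ0 : 0 < ρ := by linarith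
  -- This normalised quotient is nonincreasing from `N` on, so the sum of its first `N + 1` values
  -- bounds it everywhere.
  let u : ℕ → ℝ := fun n => |poch a n| / (ρ ^ n * |poch c n|)
  have hu : ∀ n, 0 ≤ u n := fun n => div_nonneg (abs_nonneg _) (by have := hcpos n; positivity)
  have hstep : ∀ n, N ≤ n → u (n + 1) ≤ u n := by
    intro n hn
    have h1 : u (n + 1) = u n * (|(a + n) / (c + n)| / ρ) := by
      simp only [u, poch_succ, abs_mul, abs_div, pow_succ]
      field_simp
    rw [h1]
    exact mul_le_of_le_one_right (hu n) ((div_le_one hρ0).2 (hN n hn).le)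
  have hbd : ∀ n, u n ≤ ∑ i ∈ Finset.range (N + 1), u i := by
    intro n
    rcases le_or_gt n N with h | h
    · exact Finset.single_le_sum (fun i _ => hu i) (Finset.mem_range.2 (by omega))
    · have : u n ≤ u N := by
        induction n, h.le using Nat.le_induction with
        | base => exact le_rfl
        | succ n hn ih =>
          rcases hn.eq_or_lt with h' | h'
          · subst h'; exact hstep _ le_rfl
          · exact (hstep n hn).trans (ih h')
      exact this.trans (Finset.single_le_sum (fun i _ => hu i) (Finset.mem_range.2 (by omega)))
  refine ⟨(∑ i ∈ Finset.range (N + 1), u i) + 1, by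
    have := Finset.sum_nonneg (fun i (_ : i ∈ Finset.range (N + 1)) => hu i)
    linarith, fun n => ?_⟩
  have h2 := (div_le_iff₀ (by have := hcpos n; positivity)).1 (hbd n)
  have h3 : 0 ≤ ρ ^ n * |poch c n| := by positivity
  nlinarith

/-- The Chu–Vandermonde identity. -/
lemma sum_choose_poch_div_poch (n : ℕ) (b : ℝ) {c : ℝ} (hc : ∀ m : ℕ, c ≠ -(m : ℝ)) :
    ∑ m ∈ Finset.range (n + 1), (-1) ^ m * (n.choose m : ℝ) * (poch (c - b) m / poch c m) =
      poch b n / poch c n := by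
  induction n generalizing c with
  | zero => simp
  | succ n ih =>
    have hc1 : ∀ m : ℕ, c + 1 ≠ -(m : ℝ) := by
      simpa using add_natCast_ne_neg_natCast hc 1
    have hc0 : c ≠ 0 := by simpa using hc 0
    have hcn : c + n ≠ 0 := fun h => hc n (by linarith)
    -- Pascal's rule gives `S_{n+1}(c) = S_n(c) - (c-b)/c · S_n(c+1)` with `b` fixed, which is why
    -- the induction generalises `c`.
    have h1 : ∑ m ∈ Finset.range (n + 1 + 1),
        (-1) ^ m * ((n + 1).choose m : ℝ) * (poch (c - b) m / poch c m) =
        ∑ m ∈ Finset.range (n + 1), (-1) ^ m * (n.choose m : ℝ) * (poch (c - b) m / poch c m)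
        - (c - b) / c * ∑ m ∈ Finset.range (n + 1),
          (-1) ^ m * (n.choose m : ℝ) * (poch (c + 1 - b) m / poch (c + 1) m) := by
      have h2 : ∑ m ∈ Finset.range (n + 1),
          (-1) ^ m * (n.choose m : ℝ) * (poch (c - b) m / poch c m) =
          ∑ m ∈ Finset.range (n + 1 + 1),
          (-1) ^ m * (n.choose m : ℝ) * (poch (c - b) m / poch c m) := by
        rw [Finset.sum_range_succ _ (n + 1)]
        simp
      rw [h2, Finset.sum_range_succ', Finset.sum_range_succ' _ (n + 1), Finset.mul_sum,
        add_sub_right_comm, ← Finset.sum_sub_distrib]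
      congr 1
      · refine Finset.sum_congr rfl fun m _ => ?_
        rw [Nat.choose_succ_succ, poch_succ_left, poch_succ_left c,
          show c + 1 - b = c - b + 1 by ring]
        have := poch_ne_zero hc1 m
        push_cast
        field_simp
        ring
      · simp
    rw [h1, ih hc, ih hc1]
    have e1 : c * poch (c + 1) n = poch c n * (c + n) := by
      rw [← poch_succ_left, poch_succ]
    have h3 := poch_ne_zero hc n
    have h4 := poch_ne_zero hc1 n
    have e2 : poch (c + 1) n = poch c n * (c + n) / c := by field_simp; linarith
    rw [e2, poch_succ, poch_succ]
    field_simp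
    ring

end Pochhammer

/-- The binomial series `(1 - ζ)^{-s} = ∑ (s)_n / n! ζ^n`. -/
lemma hasSum_poch_div_factorial_mul_pow (s : ℝ) {ζ : ℂ} (hζ : ‖ζ‖ < 1) :
    HasSum (fun n : ℕ => ((poch s n / (n ! : ℝ) : ℝ) : ℂ) * ζ ^ n) ((1 - ζ) ^ (-(s : ℂ))) := by
  have h := (Complex.one_div_one_sub_cpow_hasFPowerSeriesOnBall_zero (s : ℂ)).hasSum
    (y := ζ) (by simpa [enorm_eq_nnnorm, ← NNReal.coe_lt_coe] using hζ)
  rw [zero_add, one_div, ← Complex.cpow_neg] at h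
  refine h.congr_fun fun n => ?_
  have h1 : (n ! : ℝ) * Ring.choose (s + n - 1) n = poch s n := by
    have h2 := Ring.factorial_nsmul_multichoose_eq_ascPochhammer s n
    rw [Polynomial.ascPochhammer_smeval_eq_eval, nsmul_eq_mul] at h2
    rw [poch, ← h2, Ring.choose]
    ring_nf
  have h3 : Ring.choose ((s : ℂ) + n - 1) n = ((Ring.choose (s + n - 1) n : ℝ) : ℂ) := by
    rw [Complex.ofReal_choose]
    push_cast
    rfl
  rw [FormalMultilinearSeries.ofScalars_apply_eq, h3, ← h1,
    mul_div_cancel_left₀ _ (by positivity)]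
  simp

/-! ### Divergence at `-1` -/

/-- The term ratio has modulus at least one: in `(c+n)(n+1) ≤ (a+n)(b+n)` the squares cancel, and `c
≤ 2b ≤ ab` and `c+1 ≤ a+b` compare the remaining coefficients. -/
lemma one_le_abs_gaussTerm {a b c : ℝ} (ha : 2 ≤ a) (hb : 0 < b) (hc : 0 < c)
    (h1 : c + 1 ≤ a + b) (h2 : c ≤ 2 * b) (n : ℕ) : 1 ≤ |gaussTerm a b c (-1) n| := by
  have hpos : 0 < poch c n * (n ! : ℝ) := mul_pos (poch_pos hc n) (by positivity)
  have h : poch c n * (n ! : ℝ) ≤ poch a n * poch b n := by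
    induction n with
    | zero => simp
    | succ n ih =>
      have hn : (0 : ℝ) ≤ n := n.cast_nonneg
      have e1 : poch c (n + 1) * ((n + 1)! : ℝ) =
          (poch c n * (n ! : ℝ)) * ((c + n) * (n + 1)) := by
        rw [poch_succ, Nat.factorial_succ]; push_cast; ring
      have e2 : poch a (n + 1) * poch b (n + 1) =
          (poch a n * poch b n) * ((a + n) * (b + n)) := by
        rw [poch_succ, poch_succ]; ring
      rw [e1, e2]
      refine mul_le_mul (ih (mul_pos (poch_pos hc n) (by positivity))) ?_ (by positivity)
        (mul_pos (poch_pos (by linarith) n) (poch_pos hb n)).le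
      nlinarith
  have h3 : 1 ≤ poch a n * poch b n / (poch c n * (n ! : ℝ)) := (one_le_div hpos).2 h
  rw [gaussTerm, abs_mul, abs_pow, abs_neg, abs_one, one_pow, mul_one]
  exact h3.trans (le_abs_self _)

/-- Shifting all parameters by `ν` raises `a+b-c` and `2b-c` by `ν`, so eventually the terms stay at
least one in modulus and cannot tend to zero. -/
lemma eventually_not_tendsto_sum_gaussTerm (a b c : ℝ) :
    ∀ᶠ ν : ℕ in atTop, ¬ ∃ s : ℝ,
      Tendsto (fun N : ℕ => ∑ n ∈ Finset.range N, gaussTerm (a + ν) (b + ν) (c + ν) (-1) n)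
        atTop (𝓝 s) := by
  filter_upwards [tendsto_natCast_atTop_atTop.eventually_ge_atTop (2 - a),
    tendsto_natCast_atTop_atTop.eventually_gt_atTop (-b),
    tendsto_natCast_atTop_atTop.eventually_gt_atTop (-c),
    tendsto_natCast_atTop_atTop.eventually_ge_atTop (c + 1 - a - b),
    tendsto_natCast_atTop_atTop.eventually_ge_atTop (c - 2 * b)] with ν h1 h2 h3 h4 h5
  rintro ⟨s, hs⟩
  have h6 := (hs.comp (tendsto_add_atTop_nat 1)).sub hs
  simp only [Function.comp_def, Finset.sum_range_succ, add_sub_cancel_left, sub_self] at h6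
  have h7 := h6.abs
  rw [abs_zero] at h7
  have h8 := ge_of_tendsto' h7 fun n => one_le_abs_gaussTerm (a := a + ν) (b := b + ν)
    (c := c + ν) (by linarith) (by linarith) (by linarith) (by linarith) (by linarith) n
  linarith

/-! ### Gamma asymptotics and square summability -/

/-- Euler's limit for Gamma, inverted; the factor `n/(s+n)` reduces `(s)_{n+1}` to `(s)_n`. -/
lemma tendsto_poch_div_rpow {s : ℝ} (hs : ∀ m : ℕ, s ≠ -(m : ℝ)) :
    Tendsto (fun n : ℕ => poch s n / ((n : ℝ) ^ (s - 1) * (n ! : ℝ))) atTop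
      (𝓝 (Real.Gamma s)⁻¹) := by
  have h1 : ∀ n, ∏ j ∈ Finset.range n, (s + j) = poch s n := by
    intro n
    induction n with
    | zero => simp
    | succ n ih => rw [Finset.prod_range_succ, ih, poch_succ]
  have h2 := ((Real.GammaSeq_tendsto_Gamma s).inv₀ (Real.Gamma_ne_zero hs)).mul
    (tendsto_add_natCast_div 0 s)
  rw [mul_one] at h2
  refine h2.congr' ?_
  filter_upwards [eventually_gt_atTop 0] with n hn
  have hn' : (0 : ℝ) < n := by exact_mod_cast hn
  have hsn : s + n ≠ 0 := fun h => hs n (by linarith)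
  rw [Real.GammaSeq, h1, poch_succ, Real.rpow_sub hn', Real.rpow_one]
  have := poch_ne_zero hs n
  have : (n : ℝ) ^ s ≠ 0 := (Real.rpow_pos_of_pos hn' s).ne'
  field_simp
  ring

/-- Up to `Γ(α+1)` the terms are the squared norms of the Laguerre terms. They are of order
`n^(2(a+b-c)-2-α)`, and `hconv` says precisely that this exponent is below `-1`. -/
lemma summable_twoHOneCoeff_sq {α a b c : ℝ} (hα : -1 < α)
    (ha : ∀ m : ℕ, a ≠ -(m : ℝ)) (hb : ∀ m : ℕ, b ≠ -(m : ℝ)) (hc : ∀ m : ℕ, c ≠ -(m : ℝ))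
    (hconv : 0 < c - a - b + (α + 1) / 2) :
    Summable fun n => twoHOneCoeff α a b c n ^ 2 * (poch (α + 1) n / (n ! : ℝ)) := by
  have hα' : ∀ m : ℕ, α + 1 ≠ -(m : ℝ) := ne_neg_natCast_of_pos (by linarith)
  have hlim := (((tendsto_poch_div_rpow ha).mul (tendsto_poch_div_rpow hb)).div
    (tendsto_poch_div_rpow hc) (inv_ne_zero (Real.Gamma_ne_zero hc))).pow 2 |>.div
    (tendsto_poch_div_rpow hα') (inv_ne_zero (Real.Gamma_ne_zero hα'))
  refine summable_of_isBigO_nat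
    (g := fun n : ℕ => (n : ℝ) ^ (2 * (a + b - c) - 2 - α))
    (Real.summable_nat_rpow.2 (by linarith)) ?_
  refine Asymptotics.isBigO_of_div_tendsto_nhds ?_ _ (hlim.congr' ?_)
  · filter_upwards [eventually_gt_atTop 0] with n hn h
    have hn' : (0 : ℝ) < n := by exact_mod_cast hn
    exact absurd h (Real.rpow_pos_of_pos hn' _).ne'
  · filter_upwards [eventually_gt_atTop 0] with n hn
    have hn' : (0 : ℝ) < n := by exact_mod_cast hn
    have e : (n : ℝ) ^ (2 * (a + b - c) - 2 - α) =
        ((n : ℝ) ^ (a - 1) * (n : ℝ) ^ (b - 1) / (n : ℝ) ^ (c - 1)) ^ 2 /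
          (n : ℝ) ^ (α + 1 - 1) := by
      rw [← Real.rpow_add hn', ← Real.rpow_sub hn', ← Real.rpow_natCast, ← Real.rpow_mul hn'.le,
        ← Real.rpow_sub hn']
      congr 1
      push_cast
      ring
    have h1 := poch_ne_zero hα' n
    have h2 := poch_ne_zero hc n
    have p1 := (Real.rpow_pos_of_pos hn' (a - 1)).ne'
    have p2 := (Real.rpow_pos_of_pos hn' (b - 1)).ne'
    have p3 := (Real.rpow_pos_of_pos hn' (c - 1)).ne'
    have p4 := (Real.rpow_pos_of_pos hn' (α + 1 - 1)).ne'
    have e3 : ((-1 : ℝ) ^ n) ^ 2 = 1 := by rw [← pow_mul, mul_comm, pow_mul]; simp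
    simp only [Pi.div_apply]
    rw [e, twoHOneCoeff, mul_pow, e3]
    field_simp

/-! ### The Gaussian series in the unit disc -/

/-- The coefficient `(a)_n (b)_n / ((c)_n n!)` of the Gaussian hypergeometric series. -/
noncomputable def gaussCoeff (a b c : ℝ) (n : ℕ) : ℝ :=
  poch a n * poch b n / (poch c n * (n ! : ℝ))

/-- The Gaussian hypergeometric series with real parameters as a function of `ζ : ℂ`. -/
noncomputable def hypergeometricSum (a b c : ℝ) (ζ : ℂ) : ℂ :=
  ∑' n : ℕ, (gaussCoeff a b c n : ℂ) * ζ ^ n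

lemma gaussCoeff_comm (a b c : ℝ) : gaussCoeff a b c = gaussCoeff b a c := by
  funext n
  rw [gaussCoeff, gaussCoeff, mul_comm (poch a n)]

lemma hypergeometricSum_comm (a b c : ℝ) : hypergeometricSum a b c = hypergeometricSum b a c := by
  funext ζ
  rw [hypergeometricSum, hypergeometricSum, gaussCoeff_comm]

lemma ordinaryHypergeometric_real_eq_tsum (a b c x : ℝ) :
    ₂F₁ a b c x = ∑' n : ℕ, gaussCoeff a b c n * x ^ n := by
  rw [ordinaryHypergeometric_eq_tsum]
  refine tsum_congr fun n => ?_
  rw [smul_eq_mul, gaussCoeff, poch, poch, poch]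
  field_simp

lemma ofReal_ordinaryHypergeometric (a b c x : ℝ) :
    ((₂F₁ a b c x : ℝ) : ℂ) = hypergeometricSum a b c x := by
  rw [ordinaryHypergeometric_real_eq_tsum, Complex.ofReal_tsum, hypergeometricSum]
  push_cast
  rfl

lemma ordinaryHypergeometric_complex_eq_hypergeometricSum (a b c : ℝ) (ζ : ℂ) :
    ₂F₁ a b c ζ = hypergeometricSum a b c ζ := by
  rw [ordinaryHypergeometric_eq_tsum]
  refine tsum_congr fun n => ?_
  rw [Complex.real_smul, gaussCoeff, poch, poch, poch]
  push_cast
  field_simp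

lemma exists_abs_gaussCoeff_le (a b : ℝ) {c ρ : ℝ} (hc : ∀ m : ℕ, c ≠ -(m : ℝ)) (hρ : 1 < ρ) :
    ∃ C : ℝ, 0 < C ∧ ∀ n, |gaussCoeff a b c n| ≤ C * ρ ^ n := by
  -- Two quotients, `(a)_n/(c)_n` and `(b)_n/n!`, each get growth rate `√ρ`.
  have hσ : 1 < √ρ := Real.lt_sqrt_of_sq_lt (by simpa using hρ)
  obtain ⟨C, hC, h⟩ := exists_abs_poch_le a hc hσ
  obtain ⟨D, hD, h'⟩ := exists_abs_poch_le b (ne_neg_natCast_of_pos one_pos) hσ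
  refine ⟨C * D, mul_pos hC hD, fun n => ?_⟩
  have h1 := h n
  have h2 := h' n
  rw [poch_one] at h2
  have h3 : 0 < |poch c n * (n ! : ℝ)| :=
    abs_pos.2 (mul_ne_zero (poch_ne_zero hc n) (by positivity))
  rw [gaussCoeff, abs_div, div_le_iff₀ h3, abs_mul, abs_mul]
  calc |poch a n| * |poch b n| ≤ (C * √ρ ^ n * |poch c n|) * (D * √ρ ^ n * |(n ! : ℝ)|) :=
        mul_le_mul h1 h2 (abs_nonneg _) (by positivity)
    _ = C * D * (√ρ * √ρ) ^ n * (|poch c n| * |(n ! : ℝ)|) := by rw [mul_pow]; ring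
    _ = _ := by rw [Real.mul_self_sqrt (by linarith)]

lemma exists_one_lt_mul_lt_one {q : ℝ} (hq : 0 ≤ q) (hq1 : q < 1) :
    ∃ ρ : ℝ, 1 < ρ ∧ ρ * q < 1 := by
  refine ⟨2 / (1 + q), by rw [lt_div_iff₀] <;> linarith, ?_⟩
  rw [div_mul_eq_mul_div, div_lt_one] <;> linarith

lemma summable_abs_gaussCoeff_mul_pow (a b : ℝ) {c q : ℝ} (hc : ∀ m : ℕ, c ≠ -(m : ℝ))
    (hq : 0 ≤ q) (hq1 : q < 1) : Summable fun n => |gaussCoeff a b c n| * q ^ n := by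
  obtain ⟨ρ, hρ, hρq⟩ := exists_one_lt_mul_lt_one hq hq1
  obtain ⟨C, hC, h⟩ := exists_abs_gaussCoeff_le a b hc hρ
  refine Summable.of_nonneg_of_le (fun n => by positivity) (fun n => ?_)
    ((summable_geometric_of_lt_one (by positivity) hρq).mul_left C)
  rw [mul_pow, ← mul_assoc]
  exact mul_le_mul_of_nonneg_right (h n) (by positivity)

lemma summable_norm_gaussCoeff_mul_pow (a b : ℝ) {c : ℝ} {ζ : ℂ} (hc : ∀ m : ℕ, c ≠ -(m : ℝ))
    (hζ : ‖ζ‖ < 1) : Summable fun n => ‖(gaussCoeff a b c n : ℂ) * ζ ^ n‖ := by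
  simpa using summable_abs_gaussCoeff_mul_pow a b hc (norm_nonneg ζ) hζ

lemma summable_gaussTerm (a b : ℝ) {c x : ℝ} (hc : ∀ m : ℕ, c ≠ -(m : ℝ)) (hx : |x| < 1) :
    Summable (gaussTerm a b c x) := by
  refine Summable.of_norm ?_
  refine (summable_abs_gaussCoeff_mul_pow a b hc (abs_nonneg x) hx).congr fun n => ?_
  rw [gaussTerm, gaussCoeff, norm_mul, norm_pow, Real.norm_eq_abs, Real.norm_eq_abs]

lemma differentiableOn_hypergeometricSum (a b : ℝ) {c : ℝ} (hc : ∀ m : ℕ, c ≠ -(m : ℝ)) :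
    DifferentiableOn ℂ (hypergeometricSum a b c) {ζ | ‖ζ‖ < 1} := by
  intro ζ hζ
  obtain ⟨q, hq, hq1⟩ := exists_between (show ‖ζ‖ < 1 from hζ)
  have h : DifferentiableOn ℂ (hypergeometricSum a b c) (Metric.ball 0 q) := by
    refine Complex.differentiableOn_tsum_of_summable_norm
      (summable_abs_gaussCoeff_mul_pow a b hc ((norm_nonneg ζ).trans hq.le) hq1)
      (fun n => by fun_prop) Metric.isOpen_ball fun n w hw => ?_
    rw [norm_mul, norm_pow, Complex.norm_real, Real.norm_eq_abs]
    rw [mem_ball_zero_iff] at hw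
    gcongr
  exact ((h ζ (by simpa using hq)).differentiableAt
    (Metric.isOpen_ball.mem_nhds (by simpa using hq))).differentiableWithinAt

lemma hasSum_sum_antidiagonal {f : ℕ × ℕ → ℂ} {s : ℂ} (hf : HasSum f s) :
    HasSum (fun n => ∑ p ∈ Finset.HasAntidiagonal.antidiagonal n, f p) s := by
  have h := (Finset.HasAntidiagonal.sigmaAntidiagonalEquivProd (A := ℕ)).hasSum_iff.2 hf
  refine h.sigma fun n => ?_
  have h2 := Finset.hasSum (Finset.HasAntidiagonal.antidiagonal n) f
  exact h2

/-- The left side is a single term of the expansion of `(x+y)^(k+m) = 1`. The free choice of weights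
matters in `summable_abel_double`. -/
lemma choose_mul_pow_mul_pow_le_one {x y : ℝ} (hx : 0 ≤ x) (hy : 0 ≤ y) (hxy : x + y = 1)
    (k m : ℕ) : ((k + m).choose k : ℝ) * x ^ k * y ^ m ≤ 1 := by
  have h := add_pow x y (k + m)
  rw [hxy, one_pow] at h
  rw [h]
  have h2 := Finset.single_le_sum (f := fun i => x ^ i * y ^ (k + m - i) * ((k + m).choose i : ℝ))
    (s := Finset.range (k + m + 1)) (fun i _ => by positivity)
    (Finset.mem_range.2 (by omega : k < k + m + 1))
  simp only [add_tsub_cancel_left] at h2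
  linarith

lemma factorial_add_eq (k m : ℕ) :
    ((k + m)! : ℝ) = ((k + m).choose k : ℝ) * (k ! : ℝ) * (m ! : ℝ) := by
  have := Nat.choose_mul_factorial_mul_factorial (Nat.le_add_right k m)
  rw [add_tsub_cancel_left] at this
  exact_mod_cast this.symm

lemma exists_abs_poch_le_factorial (a : ℝ) {ρ : ℝ} (hρ : 1 < ρ) :
    ∃ C : ℝ, 0 < C ∧ ∀ n, |poch a n| ≤ C * ρ ^ n * (n ! : ℝ) := by
  obtain ⟨C, hC, h⟩ := exists_abs_poch_le a (ne_neg_natCast_of_pos one_pos) hρ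
  refine ⟨C, hC, fun n => ?_⟩
  simpa [poch_one] using h n

/-! ### Pfaff's transformation and continuation to the half-plane -/

lemma summable_pfaff_double (a b : ℝ) {c : ℝ} (hc : ∀ m : ℕ, c ≠ -(m : ℝ)) {ζ : ℂ}
    (hζ : ‖ζ‖ < 1 / 4) :
    Summable fun p : ℕ × ℕ => ((poch a (p.1 + p.2) * poch (c - b) p.1 /
      (poch c p.1 * (p.1 ! : ℝ) * (p.2 ! : ℝ)) : ℝ) : ℂ) * ((-1) ^ p.1 * ζ ^ (p.1 + p.2)) := by
  have hρ : (1 : ℝ) < 5 / 4 := by norm_num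
  obtain ⟨C, hC, h⟩ := exists_abs_poch_le_factorial a hρ
  obtain ⟨D, hD, h'⟩ := exists_abs_poch_le (c - b) hc hρ
  -- Here `25/8 = 2 · (5/4)²`: a `2` from the binomial coefficient and a `5/4` from each Pochhammer
  -- bound. It is below `4`, so `‖ζ‖ < 1/4` suffices.
  set q : ℝ := 25 / 8 * ‖ζ‖ with hq
  have hq0 : 0 ≤ q := by positivity
  have hq1 : q < 1 := by linarith
  have hs := summable_geometric_of_lt_one hq0 hq1
  refine Summable.of_norm_bounded ((hs.mul_of_nonneg hs (fun _ => by positivity)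
    (fun _ => by positivity)).mul_left (C * D)) ?_
  rintro ⟨m, j⟩
  have hm := h' m
  have hn := h (m + j)
  have hc0 : 0 < |poch c m| := abs_pos.2 (poch_ne_zero hc m)
  have hch := choose_mul_pow_mul_pow_le_one (x := 1 / 2) (y := 1 / 2) (by norm_num) (by norm_num)
    (by norm_num) m j
  have hch' : ((m + j).choose m : ℝ) ≤ 2 ^ (m + j) := by
    rw [mul_assoc, ← pow_add, div_pow, one_pow, mul_one_div, div_le_one (by positivity)] at hch
    exact hch
  rw [factorial_add_eq] at hn
  have h1 : |poch a (m + j) * poch (c - b) m / (poch c m * (m ! : ℝ) * (j ! : ℝ))| ≤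
      C * (5 / 4) ^ (m + j) * 2 ^ (m + j) * (D * (5 / 4) ^ m) := by
    rw [abs_div, abs_mul, abs_mul, abs_mul, Nat.abs_cast, Nat.abs_cast, div_le_iff₀ (by positivity)]
    calc |poch a (m + j)| * |poch (c - b) m|
        ≤ (C * (5 / 4) ^ (m + j) * (((m + j).choose m : ℝ) * (m ! : ℝ) * (j ! : ℝ))) *
          (D * (5 / 4) ^ m * |poch c m|) := mul_le_mul hn hm (abs_nonneg _) (by positivity)
      _ ≤ (C * (5 / 4) ^ (m + j) * (2 ^ (m + j) * (m ! : ℝ) * (j ! : ℝ))) *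
          (D * (5 / 4) ^ m * |poch c m|) := by gcongr
      _ = _ := by ring
  simp only [norm_mul, norm_pow, norm_neg, norm_one, one_pow, one_mul, Complex.norm_real,
    Real.norm_eq_abs]
  calc _ ≤ C * (5 / 4) ^ (m + j) * 2 ^ (m + j) * (D * (5 / 4) ^ m) * ‖ζ‖ ^ (m + j) := by gcongr
    _ ≤ C * (5 / 4) ^ (m + j) * 2 ^ (m + j) * (D * (5 / 4) ^ (m + j)) * ‖ζ‖ ^ (m + j) := by
        gcongr
        · norm_num
        · omega
    _ = C * D * ((5 / 4) * 2 * (5 / 4) * ‖ζ‖) ^ (m + j) := by simp only [mul_pow]; ring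
    _ = C * D * (q ^ m * q ^ j) := by rw [← pow_add, hq]; ring_nf

/-- The Pfaff transform of the Gaussian hypergeometric function. -/
noncomputable def pfaffTransform (a b c : ℝ) (ζ : ℂ) : ℂ :=
  (1 - ζ) ^ (-(a : ℂ)) * hypergeometricSum a (c - b) c (ζ / (ζ - 1))

/-- Expanding `(1-ζ)^(-a-m)` binomially and using `(a)_m (a+m)_j = (a)_{m+j}` gives a double series.
Its diagonals `m+j = n` are Chu–Vandermonde sums. -/
lemma pfaffTransform_eq_of_norm_lt (a b : ℝ) {c : ℝ} (hc : ∀ m : ℕ, c ≠ -(m : ℝ)) {ζ : ℂ}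
    (hζ : ‖ζ‖ < 1 / 4) : pfaffTransform a b c ζ = hypergeometricSum a b c ζ := by
  have hs := (summable_pfaff_double a b hc hζ).hasSum
  have hζ1 : ζ ≠ 1 := by rintro rfl; norm_num at hζ
  have hsub : 1 - ζ ≠ 0 := sub_ne_zero.2 hζ1.symm
  have h1 := hs.prod_fiberwise (g := fun m : ℕ => (1 - ζ) ^ (-(a : ℂ)) *
      ((gaussCoeff a (c - b) c m : ℂ) * (ζ / (ζ - 1)) ^ m)) fun m => by
    have hb := (hasSum_poch_div_factorial_mul_pow (a + m) (ζ := ζ) (by linarith)).mul_left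
      ((gaussCoeff a (c - b) c m : ℂ) * (-ζ) ^ m)
    convert! hb using 1
    · funext j
      rw [poch_add, gaussCoeff, neg_pow, pow_add]
      push_cast
      ring
    · have e : (1 - ζ) ^ (-((a + m : ℝ) : ℂ)) = (1 - ζ) ^ (-(a : ℂ)) * ((1 - ζ) ^ m)⁻¹ := by
        push_cast
        rw [neg_add, Complex.cpow_add _ _ hsub, Complex.cpow_neg _ (m : ℂ), Complex.cpow_natCast]
      rw [e, show ζ / (ζ - 1) = (-ζ) / (1 - ζ) by rw [← neg_sub 1 ζ, div_neg, neg_div], div_pow]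
      ring
  have h2 := hasSum_sum_antidiagonal hs
  rw [pfaffTransform, hypergeometricSum, ← tsum_mul_left, h1.tsum_eq, ← h2.tsum_eq]
  refine tsum_congr fun n => ?_
  rw [Finset.Nat.sum_antidiagonal_eq_sum_range_succ_mk]
  have h3 : ∀ k ∈ Finset.range n.succ,
      ((poch a (k + (n - k)) * poch (c - b) k / (poch c k * (k ! : ℝ) * ((n - k)! : ℝ)) : ℝ) : ℂ) *
        ((-1) ^ k * ζ ^ (k + (n - k))) =
      (((poch a n / (n ! : ℝ)) *
        ((-1) ^ k * (n.choose k : ℝ) * (poch (c - b) k / poch c k)) : ℝ) : ℂ) * ζ ^ n := by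
    intro k hk
    have hkn : k ≤ n := by rw [Finset.mem_range] at hk; omega
    rw [Nat.add_sub_cancel' hkn, Nat.cast_choose ℝ hkn]
    have h4 : ((n ! : ℝ) : ℂ) ≠ 0 := by exact_mod_cast n.factorial_ne_zero
    push_cast at h4 ⊢
    field_simp
  rw [Finset.sum_congr rfl h3, ← Finset.sum_mul, ← Complex.ofReal_sum, ← Finset.mul_sum,
    sum_choose_poch_div_poch n b hc, gaussCoeff]
  congr 2
  field_simp

/-- The half-plane consists of the points closer to `0` than to `1`. -/
lemma norm_div_sub_one_lt_one {ζ : ℂ} (hζ : ζ.re < 1 / 2) : ‖ζ / (ζ - 1)‖ < 1 := by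
  have h1 : ζ - 1 ≠ 0 := by
    intro h
    have := congrArg Complex.re h
    simp at this
    linarith
  rw [norm_div, div_lt_one (norm_pos_iff.2 h1), ← sq_lt_sq₀ (norm_nonneg _) (norm_nonneg _),
    Complex.sq_norm, Complex.sq_norm, Complex.normSq_apply, Complex.normSq_apply]
  simp
  nlinarith

lemma isOpen_re_lt_half : IsOpen {ζ : ℂ | ζ.re < 1 / 2} :=
  isOpen_lt Complex.continuous_re continuous_const

lemma analyticOnNhd_pfaffTransform (a b : ℝ) {c : ℝ} (hc : ∀ m : ℕ, c ≠ -(m : ℝ)) :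
    AnalyticOnNhd ℂ (pfaffTransform a b c) {ζ : ℂ | ζ.re < 1 / 2} := by
  refine DifferentiableOn.analyticOnNhd ?_ isOpen_re_lt_half
  have hne : ∀ ζ ∈ {ζ : ℂ | ζ.re < 1 / 2}, ζ - 1 ≠ 0 := by
    intro ζ hζ h
    have := congrArg Complex.re h
    simp at this hζ
    linarith
  refine DifferentiableOn.mul ?_ ?_
  · refine DifferentiableOn.cpow (by fun_prop) (by fun_prop) fun ζ hζ => ?_
    left
    simp at hζ ⊢
    linarith
  · refine (differentiableOn_hypergeometricSum a (c - b) hc).comp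
      (DifferentiableOn.div (by fun_prop) (by fun_prop) hne) fun ζ hζ => ?_
    exact norm_div_sub_one_lt_one hζ

lemma eventually_pfaffTransform_eq (a b : ℝ) {c : ℝ} (hc : ∀ m : ℕ, c ≠ -(m : ℝ)) :
    pfaffTransform a b c =ᶠ[𝓝 0] hypergeometricSum a b c := by
  filter_upwards [Metric.ball_mem_nhds (0 : ℂ) (by norm_num : (0 : ℝ) < 1 / 4)] with ζ hζ
  exact pfaffTransform_eq_of_norm_lt a b hc (by simpa using hζ)

/-- Pfaff's transformation. -/
lemma pfaffTransform_eq (a b : ℝ) {c : ℝ} (hc : ∀ m : ℕ, c ≠ -(m : ℝ)) {ζ : ℂ}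
    (hζ : ‖ζ‖ < 1) (hζ' : ζ.re < 1 / 2) : pfaffTransform a b c ζ = hypergeometricSum a b c ζ := by
  have hU : Metric.ball (0 : ℂ) 1 = {ζ | ‖ζ‖ < 1} := by ext; simp
  have hconv : Convex ℝ (Metric.ball (0 : ℂ) 1 ∩ {ζ : ℂ | ζ.re < 1 / 2}) :=
    (convex_ball _ _).inter (convex_halfSpace_re_lt _)
  -- Both sides are analytic on the convex intersection of disc and half-plane, so agreement near
  -- `0` suffices.
  refine AnalyticOnNhd.eqOn_of_preconnected_of_eventuallyEq
    ((analyticOnNhd_pfaffTransform a b hc).mono Set.inter_subset_right)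
    (((hU ▸ differentiableOn_hypergeometricSum a b hc).analyticOnNhd Metric.isOpen_ball).mono
      Set.inter_subset_left) hconv.isPreconnected (z₀ := 0) (by simp)
    (eventually_pfaffTransform_eq a b hc) ⟨by simpa using hζ, hζ'⟩

/-- Both sides continue the same symmetric series from a neighbourhood of `0`. At `-1` this becomes
the equality of the two replacing series. -/
lemma pfaffTransform_comm (a b : ℝ) {c : ℝ} (hc : ∀ m : ℕ, c ≠ -(m : ℝ)) {ζ : ℂ}
    (hζ : ζ.re < 1 / 2) : pfaffTransform a b c ζ = pfaffTransform b a c ζ := by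
  refine AnalyticOnNhd.eqOn_of_preconnected_of_eventuallyEq
    (analyticOnNhd_pfaffTransform a b hc) (analyticOnNhd_pfaffTransform b a hc)
    (convex_halfSpace_re_lt _).isPreconnected (z₀ := 0) (by simp) ?_ hζ
  refine (eventually_pfaffTransform_eq a b hc).trans ?_
  rw [hypergeometricSum_comm]
  exact (eventually_pfaffTransform_eq b a hc).symm

lemma pfaffTransform_neg_one (a b c : ℝ) :
    pfaffTransform a b c (-1) = (((2 : ℝ) ^ (-a) * ₂F₁ a (c - b) c (1 / 2 : ℝ) : ℝ) : ℂ) := by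
  rw [pfaffTransform, Complex.ofReal_mul, ofReal_ordinaryHypergeometric,
    Complex.ofReal_cpow (by norm_num)]
  norm_num

lemma isContinuedGaussAtNegOne_of_pfaffTransform {a b c s : ℝ} (hc : ∀ m : ℕ, c ≠ -(m : ℝ))
    (h : pfaffTransform a b c (-1) = s) : IsContinuedGaussAtNegOne a b c s :=
  ⟨pfaffTransform a b c, analyticOnNhd_pfaffTransform a b hc, fun ζ h1 h2 => by
    rw [pfaffTransform_eq a b hc h1 h2]
    exact (ordinaryHypergeometric_complex_eq_hypergeometricSum a b c ζ).symm, h⟩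

lemma two_rpow_mul_hypergeometric_comm (a b : ℝ) {c : ℝ} (hc : ∀ m : ℕ, c ≠ -(m : ℝ)) :
    (2 : ℝ) ^ (-a) * ₂F₁ a (c - b) c (1 / 2 : ℝ) = (2 : ℝ) ^ (-b) * ₂F₁ (c - a) b c (1 / 2 : ℝ) := by
  have h := pfaffTransform_comm a b hc (ζ := -1) (by norm_num)
  rw [pfaffTransform_neg_one, pfaffTransform_neg_one] at h
  have h2 : ₂F₁ b (c - a) c (1 / 2 : ℝ) = ₂F₁ (c - a) b c (1 / 2 : ℝ) := by
    rw [ordinaryHypergeometric_real_eq_tsum, ordinaryHypergeometric_real_eq_tsum, gaussCoeff_comm]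
  rw [h2] at h
  exact_mod_cast h

/-! ### The dominating double series -/

/-- The coefficients of the double series in `z` and `y` obtained by expanding
`∑ ₂F₁(a+k, c-b; c+k; y) (a)_k (b)_k / ((c)_k k! (α+1)_k) z^k`. -/
noncomputable def doubleCoeff (α a b c : ℝ) (p : ℕ × ℕ) : ℝ :=
  gaussCoeff a b c p.1 / poch (α + 1) p.1 * gaussCoeff (a + p.1) (c - b) (c + p.1) p.2

/-- The sum of the double series with coefficients `doubleCoeff`. -/
noncomputable def doubleSum (α a b c : ℝ) (z y : ℂ) : ℂ :=
  ∑' p : ℕ × ℕ, (doubleCoeff α a b c p : ℂ) * (z ^ p.1 * y ^ p.2)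

section

variable {α a b c : ℝ}

/-- The coefficient combines into `(a)_{k+m}/(c)_{k+m} · (c-b)_m/m! · (b)_k/(α+1)_k · 1/k!`. Three
quotients at rate `5/4` give `(5/4)² = 25/16` per index. The surviving `1/k!` admits every `z`, and
`25/16 · 1/2 < 1` admits `‖y‖ ≤ 1/2`. -/
lemma exists_abs_doubleCoeff_le (hα : -1 < α) (hc : ∀ m : ℕ, c ≠ -(m : ℝ)) :
    ∃ K : ℝ, 0 < K ∧ ∀ p : ℕ × ℕ,
      |doubleCoeff α a b c p| ≤ K * ((25 / 16) ^ p.1 / (p.1 ! : ℝ) * (25 / 16) ^ p.2) := by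
  have hρ : (1 : ℝ) < 5 / 4 := by norm_num
  obtain ⟨C, hC, h⟩ := exists_abs_poch_le a hc hρ
  obtain ⟨D, hD, h'⟩ := exists_abs_poch_le_factorial (c - b) hρ
  obtain ⟨E, hE, h''⟩ := exists_abs_poch_le b
    (ne_neg_natCast_of_pos (show 0 < α + 1 by linarith)) hρ
  refine ⟨C * D * E, by positivity, ?_⟩
  rintro ⟨k, m⟩
  have hc1 : 0 < |poch c (k + m)| := abs_pos.2 (poch_ne_zero hc _)
  have hp : 0 < |poch (α + 1) k| := abs_pos.2 (poch_pos (by linarith) k).ne'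
  have e : doubleCoeff α a b c (k, m) = (poch a (k + m) * poch (c - b) m * poch b k) /
      (poch c (k + m) * (m ! : ℝ) * poch (α + 1) k * (k ! : ℝ)) := by
    simp only [doubleCoeff, gaussCoeff, poch_add]
    have h1 := poch_ne_zero hc k
    have h2 := poch_ne_zero (add_natCast_ne_neg_natCast hc k) m
    have h3 := abs_pos.1 hp
    field_simp
  rw [e, abs_div, div_le_iff₀ (by
    rw [abs_mul, abs_mul, abs_mul, Nat.abs_cast, Nat.abs_cast]; positivity)]
  simp only [abs_mul, Nat.abs_cast]
  calc |poch a (k + m)| * |poch (c - b) m| * |poch b k|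
      ≤ (C * (5 / 4) ^ (k + m) * |poch c (k + m)|) * (D * (5 / 4) ^ m * (m ! : ℝ)) *
        (E * (5 / 4) ^ k * |poch (α + 1) k|) := by
        gcongr
        exacts [h _, h' _, h'' _]
    _ = _ := by
        rw [show (25 / 16 : ℝ) = 5 / 4 * (5 / 4) by norm_num, mul_pow, mul_pow, pow_add]
        field_simp

lemma summable_doubleCoeff_bound (K Z : ℝ) (hZ : 0 ≤ Z) :
    Summable fun p : ℕ × ℕ => K * (((25 / 16) ^ p.1 / (p.1 ! : ℝ) * (25 / 16) ^ p.2) *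
      (Z ^ p.1 * (1 / 2) ^ p.2)) := by
  have h1 := Real.summable_pow_div_factorial (25 / 16 * Z)
  have h2 := summable_geometric_of_lt_one (r := 25 / 16 * (1 / 2 : ℝ)) (by norm_num) (by norm_num)
  refine ((h1.mul_of_nonneg h2 (fun _ => by positivity) (fun _ => by positivity)).mul_left K).congr
    fun p => ?_
  rw [mul_pow, mul_pow]
  ring

lemma norm_doubleSum_term_le {K Z : ℝ} (hZ : 0 ≤ Z) (hK : 0 < K) {p : ℕ × ℕ}
    (h : |doubleCoeff α a b c p| ≤ K * ((25 / 16) ^ p.1 / (p.1 ! : ℝ) * (25 / 16) ^ p.2))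
    {z y : ℂ} (hz : ‖z‖ ≤ Z) (hy : ‖y‖ ≤ 1 / 2) :
    ‖(doubleCoeff α a b c p : ℂ) * (z ^ p.1 * y ^ p.2)‖ ≤
      K * (((25 / 16) ^ p.1 / (p.1 ! : ℝ) * (25 / 16) ^ p.2) * (Z ^ p.1 * (1 / 2) ^ p.2)) := by
  rw [norm_mul, norm_mul, norm_pow, norm_pow, Complex.norm_real, Real.norm_eq_abs, ← mul_assoc K]
  gcongr

lemma summable_doubleSum (hα : -1 < α) (hc : ∀ m : ℕ, c ≠ -(m : ℝ)) (z : ℂ) {y : ℂ}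
    (hy : ‖y‖ ≤ 1 / 2) :
    Summable fun p : ℕ × ℕ => (doubleCoeff α a b c p : ℂ) * (z ^ p.1 * y ^ p.2) := by
  obtain ⟨K, hK, h⟩ := exists_abs_doubleCoeff_le (a := a) (b := b) hα hc
  exact Summable.of_norm_bounded (summable_doubleCoeff_bound K ‖z‖ (norm_nonneg z))
    fun p => norm_doubleSum_term_le (norm_nonneg z) hK (h p) le_rfl hy

lemma hasSum_doubleSum_fiberwise (hα : -1 < α) (hc : ∀ m : ℕ, c ≠ -(m : ℝ)) (z : ℂ) {y : ℂ}
    (hy : ‖y‖ ≤ 1 / 2) :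
    HasSum (fun k : ℕ => ((gaussCoeff a b c k / poch (α + 1) k : ℝ) : ℂ) * z ^ k *
      hypergeometricSum (a + k) (c - b) (c + k) y) (doubleSum α a b c z y) := by
  refine (summable_doubleSum hα hc z hy).hasSum.prod_fiberwise fun k => ?_
  have h := (summable_norm_gaussCoeff_mul_pow (a + k) (c - b) (ζ := y)
    (add_natCast_ne_neg_natCast hc k) (by linarith)).of_norm.hasSum.mul_left
    (((gaussCoeff a b c k / poch (α + 1) k : ℝ) : ℂ) * z ^ k)
  convert! h using 1
  funext m
  simp only [doubleCoeff]
  push_cast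
  ring

lemma differentiable_doubleSum (hα : -1 < α) (hc : ∀ m : ℕ, c ≠ -(m : ℝ)) {y : ℂ}
    (hy : ‖y‖ ≤ 1 / 2) : Differentiable ℂ fun z => doubleSum α a b c z y := by
  intro z
  obtain ⟨K, hK, h⟩ := exists_abs_doubleCoeff_le (a := a) (b := b) hα hc
  have h1 : DifferentiableOn ℂ (fun z => doubleSum α a b c z y) (Metric.ball 0 (‖z‖ + 1)) := by
    refine Complex.differentiableOn_tsum_of_summable_norm
      (summable_doubleCoeff_bound K (‖z‖ + 1) (by positivity)) (fun p => by fun_prop)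
      Metric.isOpen_ball fun p w hw => ?_
    exact norm_doubleSum_term_le (by positivity) hK (h p) (mem_ball_zero_iff.1 hw).le hy
  have hz : z ∈ Metric.ball (0 : ℂ) (‖z‖ + 1) := by simp
  exact (h1 z hz).differentiableAt (Metric.isOpen_ball.mem_nhds hz)

lemma hasSum_powerTermFst (hα : -1 < α) (hc : ∀ m : ℕ, c ≠ -(m : ℝ)) (z : ℂ) :
    HasSum (powerTermFst α a b c z) (doubleSum α a b c (z / 2) (1 / 2)) := by
  have h := hasSum_doubleSum_fiberwise (a := a) (b := b) hα hc (z / 2) (y := 1 / 2) (by norm_num)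
  refine h.congr_fun fun k => ?_
  rw [powerTermFst, ← gaussCoeff, Complex.ofReal_mul, ofReal_ordinaryHypergeometric]
  push_cast
  ring

/-- The two power series agree term by term: the equality with shifted parameters carries a common
factor `2^(-ν)`, which cancels. -/
lemma two_rpow_mul_powerTermFst (hc : ∀ m : ℕ, c ≠ -(m : ℝ)) (z : ℂ) (ν : ℕ) :
    (((2 : ℝ) ^ (-a) : ℝ) : ℂ) * powerTermFst α a b c z ν =
      (((2 : ℝ) ^ (-b) : ℝ) : ℂ) * powerTermSnd α a b c z ν := by
  have h := two_rpow_mul_hypergeometric_comm (a + ν) (b + ν) (add_natCast_ne_neg_natCast hc ν)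
  rw [add_sub_add_right_eq_sub, add_sub_add_right_eq_sub, neg_add, neg_add,
    Real.rpow_add two_pos, Real.rpow_add two_pos] at h
  have h2 : (2 : ℝ) ^ (-(ν : ℝ)) ≠ 0 := (Real.rpow_pos_of_pos two_pos _).ne'
  have h3 : (2 : ℝ) ^ (-a) * ₂F₁ (a + ν) (c - b) (c + ν) (1 / 2 : ℝ) =
      (2 : ℝ) ^ (-b) * ₂F₁ (c - a) (b + ν) (c + ν) (1 / 2 : ℝ) :=
    mul_left_cancel₀ h2 (by linear_combination h)
  rw [powerTermFst, powerTermSnd, ← mul_assoc, ← mul_assoc, ← Complex.ofReal_mul,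
    ← Complex.ofReal_mul, ← mul_assoc, ← mul_assoc, h3]

/-! ### Abel means of the Laguerre series -/

lemma summable_abel_double (hα : -1 < α) (hc : ∀ m : ℕ, c ≠ -(m : ℝ)) (z : ℂ) {r : ℝ}
    (hr : 0 ≤ r) (hr1 : r < 1) :
    Summable fun p : ℕ × ℕ => ((gaussCoeff a b c (p.1 + p.2) * ((p.1 + p.2)! : ℝ) /
      ((p.1 ! : ℝ) * (p.2 ! : ℝ) * poch (α + 1) p.1) : ℝ) : ℂ) *
        ((r * z) ^ p.1 * (-(r : ℂ)) ^ p.2) := by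
  obtain ⟨σ, hσ, hσr⟩ := exists_one_lt_mul_lt_one hr hr1
  set q := σ * r with hq
  have hq0 : 0 ≤ q := by positivity
  obtain ⟨C, hC, h⟩ := exists_abs_gaussCoeff_le a b hc hσ
  obtain ⟨D, hD, h'⟩ := exists_abs_poch_le 1
    (ne_neg_natCast_of_pos (show 0 < α + 1 by linarith)) one_lt_two
  -- The binomial coefficient is at most `x^(-k) y^(-m)` when `x + y = 1`. Taking `q < y < 1` keeps
  -- the sum over `m` geometric for every `r < 1`; the loss `x^(-k)` is absorbed by `1/(α+1)_k ≤ D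
  -- 2^k/k!`.
  set y : ℝ := (1 + q) / 2 with hy
  set x : ℝ := (1 - q) / 2 with hx
  have hx0 : 0 < x := by linarith
  have hy0 : 0 < y := by linarith
  have hqy : q / y < 1 := by rw [div_lt_one hy0]; linarith
  have h1 := Real.summable_pow_div_factorial (2 * q * ‖z‖ / x)
  have h2 := summable_geometric_of_lt_one (r := q / y) (by positivity) hqy
  refine Summable.of_norm_bounded ((h1.mul_of_nonneg h2 (fun _ => by positivity)
    (fun _ => by positivity)).mul_left (C * D)) ?_
  rintro ⟨k, m⟩
  have hch := choose_mul_pow_mul_pow_le_one hx0.le hy0.le (by rw [hx, hy]; ring) k m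
  have hp : 0 < poch (α + 1) k := poch_pos (by linarith) k
  have hk := h' k
  rw [poch_one, Nat.abs_cast, abs_of_pos hp] at hk
  have hch2 : ((k + m).choose k : ℝ) ≤ 1 / (x ^ k * y ^ m) := by
    rw [le_div_iff₀ (by positivity), ← mul_assoc]
    exact hch
  have hk2 : 1 / poch (α + 1) k ≤ D * 2 ^ k / (k ! : ℝ) := by
    rw [div_le_div_iff₀ hp (by positivity), one_mul]
    exact hk
  have e : |gaussCoeff a b c (k + m) * ((k + m)! : ℝ) /
      ((k ! : ℝ) * (m ! : ℝ) * poch (α + 1) k)| =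
      |gaussCoeff a b c (k + m)| * ((k + m).choose k : ℝ) * (1 / poch (α + 1) k) := by
    rw [abs_div, abs_mul, abs_mul, abs_mul, Nat.abs_cast, Nat.abs_cast, Nat.abs_cast,
      abs_of_pos hp, factorial_add_eq]
    field_simp
  simp only [norm_mul, norm_pow, norm_neg, Complex.norm_real, Real.norm_eq_abs, e, abs_of_nonneg hr]
  calc _ ≤ (C * σ ^ (k + m)) * (1 / (x ^ k * y ^ m)) * (D * 2 ^ k / (k ! : ℝ)) *
        ((r * ‖z‖) ^ k * r ^ m) := by
        gcongr
        exact h _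
    _ = _ := by
        rw [hq]
        simp only [mul_pow, div_pow, pow_add]
        field_simp

/-- The factor `(α+1)_n` cancels and `(-n)_k` becomes a signed binomial coefficient. Each damped
Laguerre term is thus a diagonal of the double series, ready for rearrangement. -/
lemma twoHOneCoeff_mul_laguerreL (hα : -1 < α) (n : ℕ) (z : ℂ) (r : ℝ) :
    ((twoHOneCoeff α a b c n * r ^ n : ℝ) : ℂ) * laguerreL α n z =
      ∑ p ∈ Finset.HasAntidiagonal.antidiagonal n,
        ((gaussCoeff a b c (p.1 + p.2) * ((p.1 + p.2)! : ℝ) /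
          ((p.1 ! : ℝ) * (p.2 ! : ℝ) * poch (α + 1) p.1) : ℝ) : ℂ) *
          ((r * z) ^ p.1 * (-(r : ℂ)) ^ p.2) := by
  rw [Finset.Nat.sum_antidiagonal_eq_sum_range_succ_mk, laguerreL, ← mul_assoc, Finset.mul_sum]
  refine Finset.sum_congr rfl fun k hk => ?_
  have hkn : k ≤ n := by rw [Finset.mem_range] at hk; omega
  obtain ⟨m, rfl⟩ := Nat.exists_eq_add_of_le hkn
  simp only [add_tsub_cancel_left]
  have hp : ∀ k, poch (α + 1) k ≠ 0 := fun k => (poch_pos (by linarith) k).ne'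
  have e : twoHOneCoeff α a b c (k + m) * (poch (α + 1) (k + m) / ((k + m)! : ℝ)) *
      (poch (-((k + m : ℕ) : ℝ)) k / (poch (α + 1) k * (k ! : ℝ))) =
      gaussCoeff a b c (k + m) * ((k + m)! : ℝ) /
          ((k ! : ℝ) * (m ! : ℝ) * poch (α + 1) k) * (-1) ^ m := by
    have h1 := hp k
    have h2 := hp (k + m)
    have h3 : ((-1 : ℝ) ^ k) ^ 2 = 1 := by rw [← pow_mul, mul_comm, pow_mul]; simp
    rw [twoHOneCoeff, poch_neg_natCast, gaussCoeff, factorial_add_eq, pow_add]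
    have h4 : ((k + m).choose k : ℝ) ≠ 0 := by
      exact_mod_cast (Nat.choose_pos (Nat.le_add_right k m)).ne'
    field_simp
    linear_combination (poch a (k + m) * poch b (k + m) / poch c (k + m)) * h3
  have e2 := congrArg (fun t : ℝ => (t : ℂ)) e
  simp only [Complex.ofReal_mul] at e2 ⊢
  rw [neg_pow (r : ℂ), mul_pow, Complex.ofReal_pow, pow_add]
  rw [Complex.ofReal_pow, Complex.ofReal_neg, Complex.ofReal_one] at e2
  linear_combination (r : ℂ) ^ k * (r : ℂ) ^ m * z ^ k * e2

/-- The Abel sums of the Laguerre series in terms of the double series. -/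
lemma hasSum_abel_laguerre (hα : -1 < α) (hc : ∀ m : ℕ, c ≠ -(m : ℝ)) (z : ℂ) {r : ℝ}
    (hr : 0 ≤ r) (hr1 : r < 1) :
    HasSum (fun n => ((twoHOneCoeff α a b c n * r ^ n : ℝ) : ℂ) * laguerreL α n z)
      ((1 + (r : ℂ)) ^ (-(a : ℂ)) *
        doubleSum α a b c (z * ((r / (1 + r) : ℝ) : ℂ)) ((r / (1 + r) : ℝ) : ℂ)) := by
  have hs := (summable_abel_double (a := a) (b := b) hα hc z hr hr1).hasSum
  have h1 := hasSum_sum_antidiagonal hs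
  have hr2 : ‖((r / (1 + r) : ℝ) : ℂ)‖ ≤ 1 / 2 := by
    rw [Complex.norm_real, Real.norm_of_nonneg (by positivity), div_le_div_iff₀] <;> linarith
  have hr3 : (1 + r : ℂ) ≠ 0 := by
    have : (1 + r : ℝ) ≠ 0 := by positivity
    exact_mod_cast this
  have h2 := hs.prod_fiberwise (g := fun k : ℕ => ((gaussCoeff a b c k / poch (α + 1) k : ℝ) : ℂ) *
      (r * z) ^ k * hypergeometricSum (a + k) (b + k) (c + k) (-r)) fun k => by
    have hck := add_natCast_ne_neg_natCast hc k
    have h := (summable_norm_gaussCoeff_mul_pow (a + k) (b + k) (ζ := -(r : ℂ)) hck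
      (by rwa [norm_neg, Complex.norm_real, Real.norm_of_nonneg hr])).of_norm.hasSum.mul_left
      (((gaussCoeff a b c k / poch (α + 1) k : ℝ) : ℂ) * (r * z) ^ k)
    convert! h using 1
    funext m
    have e : gaussCoeff a b c (k + m) * ((k + m)! : ℝ) /
        ((k ! : ℝ) * (m ! : ℝ) * poch (α + 1) k) =
        gaussCoeff a b c k / poch (α + 1) k * gaussCoeff (a + k) (b + k) (c + k) m := by
      simp only [gaussCoeff, poch_add]
      field_simp
    simp only [e]
    push_cast
    ring
  have h3 := (hasSum_doubleSum_fiberwise (a := a) (b := b) hα hc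
    (z * ((r / (1 + r) : ℝ) : ℂ)) hr2).mul_left ((1 + (r : ℂ)) ^ (-(a : ℂ)))
  -- Pfaff at `-r`: the factor `(1+r)^(-k)` joins `(r z)^k` to form `(z r/(1+r))^k`, leaving
  -- `(1+r)^(-a)` independent of `k`.
  have h4 : ∀ k : ℕ, (1 + (r : ℂ)) ^ (-(a : ℂ)) *
      (((gaussCoeff a b c k / poch (α + 1) k : ℝ) : ℂ) * (z * ((r / (1 + r) : ℝ) : ℂ)) ^ k *
        hypergeometricSum (a + k) (c - b) (c + k) ((r / (1 + r) : ℝ) : ℂ)) =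
      ((gaussCoeff a b c k / poch (α + 1) k : ℝ) : ℂ) *
      (r * z) ^ k * hypergeometricSum (a + k) (b + k) (c + k) (-r) := by
    intro k
    rw [← pfaffTransform_eq (a + k) (b + k) (add_natCast_ne_neg_natCast hc k)
      (by rwa [norm_neg, Complex.norm_real, Real.norm_of_nonneg hr]) (by simp; linarith),
      pfaffTransform, add_sub_add_right_eq_sub, sub_neg_eq_add,
      show -(r : ℂ) / (-r - 1) = ((r / (1 + r) : ℝ) : ℂ) by
        rw [← neg_add', div_neg, neg_div, neg_neg, add_comm]; push_cast; rfl]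
    have e : (1 + (r : ℂ)) ^ (-((a + k : ℝ) : ℂ)) =
        (1 + (r : ℂ)) ^ (-(a : ℂ)) * ((1 + (r : ℂ)) ^ k)⁻¹ := by
      push_cast
      rw [neg_add, Complex.cpow_add _ _ hr3, Complex.cpow_neg _ (k : ℂ), Complex.cpow_natCast]
    have e' : (((r / (1 + r) : ℝ) : ℂ)) ^ k = (r : ℂ) ^ k * ((1 + (r : ℂ)) ^ k)⁻¹ := by
      push_cast
      rw [div_pow, div_eq_mul_inv]
    rw [e, mul_pow, mul_pow, e']
    ring
  simp only [h4] at h3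
  rw [h3.unique h2]
  simpa only [twoHOneCoeff_mul_laguerreL hα] using h1

/-- The entire function represented by the Laguerre series. -/
noncomputable def twoHOne (α a b c : ℝ) (z : ℂ) : ℂ :=
  (((2 : ℝ) ^ (-a) : ℝ) : ℂ) * doubleSum α a b c (z / 2) (1 / 2)

lemma differentiable_twoHOne (hα : -1 < α) (hc : ∀ m : ℕ, c ≠ -(m : ℝ)) :
    Differentiable ℂ (twoHOne α a b c) :=
  ((differentiable_doubleSum hα hc (by norm_num)).comp
    (differentiable_id.div_const 2)).const_mul _

/-- Since `r/(1+r) ≤ 1/2`, the bound on the double coefficients dominates uniformly in `j`. -/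
lemma tendsto_abel_laguerre (hα : -1 < α) (hc : ∀ m : ℕ, c ≠ -(m : ℝ)) (z : ℂ) {r : ℕ → ℝ}
    (hr : ∀ j, 0 ≤ r j) (hr1 : ∀ j, r j < 1) (hlim : Tendsto r atTop (𝓝 1)) :
    Tendsto (fun j => ∑' n, ((twoHOneCoeff α a b c n * r j ^ n : ℝ) : ℂ) * laguerreL α n z)
      atTop (𝓝 (twoHOne α a b c z)) := by
  simp only [fun j => (hasSum_abel_laguerre (a := a) (b := b) hα hc z (hr j) (hr1 j)).tsum_eq]
  have hy : Tendsto (fun j => ((r j / (1 + r j) : ℝ) : ℂ)) atTop (𝓝 (1 / 2)) := by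
    have h := hlim.div (hlim.const_add 1) (by norm_num)
    have h2 := (Complex.continuous_ofReal.tendsto _).comp h
    convert! h2 using 2
    norm_num
  have hynorm : ∀ j, ‖((r j / (1 + r j) : ℝ) : ℂ)‖ ≤ 1 / 2 := by
    intro j
    have h1 := hr j
    have h2 := hr1 j
    rw [Complex.norm_real, Real.norm_of_nonneg (by positivity), div_le_div_iff₀] <;> linarith
  refine Tendsto.mul ?_ ?_
  · have h : Tendsto (fun j => (1 + r j) ^ (-a)) atTop (𝓝 ((1 + 1 : ℝ) ^ (-a))) :=
      (hlim.const_add 1).rpow_const (Or.inl (by norm_num))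
    have h2 := (Complex.continuous_ofReal.tendsto _).comp h
    rw [one_add_one_eq_two] at h2
    refine h2.congr fun j => ?_
    have := hr j
    rw [Function.comp_apply, Complex.ofReal_cpow (by linarith)]
    push_cast
    rfl
  · obtain ⟨K, hK, h⟩ := exists_abs_doubleCoeff_le (a := a) (b := b) hα hc
    refine tendsto_tsum_of_dominated_convergence
      (summable_doubleCoeff_bound K ‖z‖ (norm_nonneg z)) (fun p => ?_)
      (Eventually.of_forall fun j p => norm_doubleSum_term_le (norm_nonneg z) hK (h p) ?_ (hynorm j))
    · refine Tendsto.const_mul _ (Tendsto.mul (Tendsto.pow ?_ _) (hy.pow _))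
      rw [div_eq_mul_one_div]
      exact hy.const_mul z
    · rw [norm_mul]
      have := hynorm j
      have := norm_nonneg z
      nlinarith
end

/-! ### Orthogonality of the Laguerre polynomials -/

section Orthogonality

variable {α : ℝ}

lemma measurable_laguerreDensity :
    Measurable fun x : ℝ => ENNReal.ofReal (x ^ α * Real.exp (-x)) := by fun_prop

/-- The density is positive off the null point `0`, so almost everywhere statements pass back to
Lebesgue measure. -/
lemma ae_laguerreMeasure_le :
    ae (volume.restrict (Set.Ici (0 : ℝ))) ≤ ae (laguerreMeasure α) := by
  refine (withDensity_absolutelyContinuous' measurable_laguerreDensity.aemeasurable ?_).ae_le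
  rw [← Measure.restrict_congr_set Ioi_ae_eq_Ici]
  filter_upwards [ae_restrict_mem measurableSet_Ioi] with x hx
  have : 0 < x := hx
  exact (ENNReal.ofReal_pos.2 (by positivity)).ne'

lemma laguerreDensity_smul_pow_ae_eq (k : ℕ) :
    (fun x : ℝ => (ENNReal.ofReal (x ^ α * Real.exp (-x))).toReal • x ^ k)
      =ᵐ[volume.restrict (Set.Ioi 0)] fun x => Real.exp (-x) * x ^ (α + 1 + k - 1) := by
  filter_upwards [ae_restrict_mem measurableSet_Ioi] with x hx
  have hx0 : 0 < x := hx
  rw [ENNReal.toReal_ofReal (by positivity), show α + 1 + k - 1 = α + k by ring,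
    Real.rpow_add hx0, Real.rpow_natCast, smul_eq_mul]
  ring

lemma integrable_pow_laguerreMeasure (hα : -1 < α) (k : ℕ) :
    Integrable (fun x : ℝ => x ^ k) (laguerreMeasure α) := by
  rw [laguerreMeasure, integrable_withDensity_iff_integrable_smul' measurable_laguerreDensity
    (Eventually.of_forall fun _ => ENNReal.ofReal_lt_top),
    ← Measure.restrict_congr_set Ioi_ae_eq_Ici, integrable_congr (laguerreDensity_smul_pow_ae_eq k)]
  have : (0 : ℝ) ≤ k := k.cast_nonneg
  exact Real.GammaIntegral_convergent (by linarith)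

lemma Gamma_add_natCast {s : ℝ} (hs : 0 < s) (k : ℕ) :
    Real.Gamma (s + k) = Real.Gamma s * poch s k := by
  induction k with
  | zero => simp
  | succ k ih =>
    have : s + k ≠ 0 := by positivity
    rw [Nat.cast_succ, ← add_assoc, Real.Gamma_add_one this, ih, poch_succ]
    ring

lemma integral_pow_laguerreMeasure (hα : -1 < α) (k : ℕ) :
    ∫ x : ℝ, x ^ k ∂laguerreMeasure α = Real.Gamma (α + 1) * poch (α + 1) k := by
  have : (0 : ℝ) ≤ k := k.cast_nonneg
  rw [laguerreMeasure, integral_withDensity_eq_integral_toReal_smul measurable_laguerreDensity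
    (Eventually.of_forall fun _ => ENNReal.ofReal_lt_top),
    ← Measure.restrict_congr_set Ioi_ae_eq_Ici, integral_congr_ae (laguerreDensity_smul_pow_ae_eq k),
    ← Real.Gamma_eq_integral (by linarith), Gamma_add_natCast (by linarith)]

/-- The Laguerre polynomial as a function of a real variable. -/
noncomputable def realLaguerre (α : ℝ) (n : ℕ) (x : ℝ) : ℝ :=
  poch (α + 1) n / (n ! : ℝ) *
    ∑ k ∈ Finset.range (n + 1), poch (-(n : ℝ)) k / (poch (α + 1) k * (k ! : ℝ)) * x ^ k

lemma laguerreL_ofReal (n : ℕ) (x : ℝ) : laguerreL α n (x : ℂ) = (realLaguerre α n x : ℂ) := by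
  simp only [laguerreL, realLaguerre]
  push_cast
  rfl

@[fun_prop]
lemma continuous_realLaguerre (n : ℕ) : Continuous (realLaguerre α n) := by
  unfold realLaguerre
  fun_prop

lemma pow_mul_realLaguerre (n k : ℕ) (x : ℝ) :
    x ^ k * realLaguerre α n x = ∑ j ∈ Finset.range (n + 1), poch (α + 1) n / (n ! : ℝ) *
      (poch (-(n : ℝ)) j / (poch (α + 1) j * (j ! : ℝ))) * x ^ (k + j) := by
  rw [realLaguerre, Finset.mul_sum, Finset.mul_sum]
  exact Finset.sum_congr rfl fun j _ => by ring

lemma integrable_pow_mul_realLaguerre (hα : -1 < α) (n k : ℕ) :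
    Integrable (fun x : ℝ => x ^ k * realLaguerre α n x) (laguerreMeasure α) := by
  simp only [pow_mul_realLaguerre]
  exact integrable_finsetSum _ fun j _ => (integrable_pow_laguerreMeasure hα _).const_mul _

/-- Gamma moments reduce this to Chu–Vandermonde with parameters `-k` and `α+1`. The factor `(-k)_n`
vanishes for `k < n`, which is the orthogonality. -/
lemma integral_pow_mul_realLaguerre (hα : -1 < α) (n k : ℕ) :
    ∫ x : ℝ, x ^ k * realLaguerre α n x ∂laguerreMeasure α =
      Real.Gamma (α + 1) * poch (α + 1) k * poch (-(k : ℝ)) n / (n ! : ℝ) := by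
  have hα' : ∀ m : ℕ, α + 1 ≠ -(m : ℝ) := ne_neg_natCast_of_pos (by linarith)
  simp only [pow_mul_realLaguerre]
  rw [integral_finsetSum _ fun j _ => (integrable_pow_laguerreMeasure hα _).const_mul _]
  simp only [integral_const_mul, integral_pow_laguerreMeasure hα]
  have h := sum_choose_poch_div_poch n (-(k : ℝ)) hα'
  rw [sub_neg_eq_add] at h
  have hn := poch_ne_zero hα' n
  have e : Real.Gamma (α + 1) * poch (α + 1) k * poch (-(k : ℝ)) n / (n ! : ℝ) =
      Real.Gamma (α + 1) * poch (α + 1) k * (poch (α + 1) n / (n ! : ℝ)) *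
        (poch (-(k : ℝ)) n / poch (α + 1) n) := by
    field_simp
  rw [e, ← h, Finset.mul_sum]
  refine Finset.sum_congr rfl fun j _ => ?_
  have hj := poch_ne_zero hα' j
  rw [poch_neg_natCast, poch_add]
  field_simp

lemma integrable_realLaguerre_mul (hα : -1 < α) (m n : ℕ) :
    Integrable (fun x : ℝ => realLaguerre α m x * realLaguerre α n x) (laguerreMeasure α) := by
  have h : ∀ x, realLaguerre α m x * realLaguerre α n x =
      ∑ k ∈ Finset.range (m + 1), poch (α + 1) m / (m ! : ℝ) *
        (poch (-(m : ℝ)) k / (poch (α + 1) k * (k ! : ℝ))) * (x ^ k * realLaguerre α n x) := by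
    intro x
    rw [realLaguerre, Finset.mul_sum, Finset.sum_mul]
    exact Finset.sum_congr rfl fun j _ => by ring
  simp only [h]
  exact integrable_finsetSum _ fun j _ => (integrable_pow_mul_realLaguerre hα _ _).const_mul _

lemma integral_realLaguerre_mul_of_le (hα : -1 < α) {m n : ℕ} (hmn : m ≤ n) :
    ∫ x : ℝ, realLaguerre α m x * realLaguerre α n x ∂laguerreMeasure α =
      if m = n then Real.Gamma (α + 1) * (poch (α + 1) n / (n ! : ℝ)) else 0 := by
  have h : ∀ x, realLaguerre α m x * realLaguerre α n x =
      ∑ k ∈ Finset.range (m + 1), poch (α + 1) m / (m ! : ℝ) *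
        (poch (-(m : ℝ)) k / (poch (α + 1) k * (k ! : ℝ))) * (x ^ k * realLaguerre α n x) := by
    intro x
    rw [realLaguerre, Finset.mul_sum, Finset.sum_mul]
    exact Finset.sum_congr rfl fun j _ => by ring
  simp only [h]
  rw [integral_finsetSum _ fun j _ => (integrable_pow_mul_realLaguerre hα _ _).const_mul _]
  simp only [integral_const_mul, integral_pow_mul_realLaguerre hα]
  -- Only the top power `x^m` can survive, and only if `m = n`.
  rw [Finset.sum_range_succ, Finset.sum_eq_zero, zero_add]
  · split_ifs with hmn'
    · subst hmn'
      rw [poch_neg_natCast, Nat.choose_self]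
      have h1 := (poch_pos (show 0 < α + 1 by linarith) m).ne'
      have h3 : ((-1 : ℝ) ^ m) ^ 2 = 1 := by rw [← pow_mul, mul_comm, pow_mul]; simp
      field_simp
      simp [h3]
    · rw [poch_neg_natCast m n, Nat.choose_eq_zero_of_lt (by omega)]
      simp
  · intro k hk
    rw [Finset.mem_range] at hk
    rw [poch_neg_natCast k n, Nat.choose_eq_zero_of_lt (by omega)]
    simp

lemma integral_realLaguerre_mul (hα : -1 < α) (m n : ℕ) :
    ∫ x : ℝ, realLaguerre α m x * realLaguerre α n x ∂laguerreMeasure α =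
      if m = n then Real.Gamma (α + 1) * (poch (α + 1) n / (n ! : ℝ)) else 0 := by
  rcases le_total m n with h | h
  · exact integral_realLaguerre_mul_of_le hα h
  · have h2 := integral_realLaguerre_mul_of_le hα h
    simp only [mul_comm (realLaguerre α m _)]
    rw [h2]
    rcases eq_or_ne m n with rfl | h3
    · rfl
    · rw [if_neg h3, if_neg h3.symm]

lemma sq_sum_realLaguerre (d : ℕ → ℝ) (M : ℕ) (x : ℝ) :
    ‖((∑ n ∈ Finset.range M, d n * realLaguerre α n x : ℝ) : ℂ)‖ ^ 2 =
      ∑ m ∈ Finset.range M, ∑ n ∈ Finset.range M,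
        d m * d n * (realLaguerre α m x * realLaguerre α n x) := by
  rw [Complex.norm_real, Real.norm_eq_abs, sq_abs, sq, Finset.sum_mul_sum]
  exact Finset.sum_congr rfl fun m _ => Finset.sum_congr rfl fun n _ => by ring

/-- Parseval's identity for finite Laguerre sums. -/
lemma eLpNorm_sum_realLaguerre (hα : -1 < α) (d : ℕ → ℝ) (M : ℕ) :
    eLpNorm (fun x : ℝ => ((∑ n ∈ Finset.range M, d n * realLaguerre α n x : ℝ) : ℂ)) 2
      (laguerreMeasure α) = ENNReal.ofReal (√(∑ n ∈ Finset.range M,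
        d n ^ 2 * (Real.Gamma (α + 1) * (poch (α + 1) n / (n ! : ℝ))))) := by
  have hmeas : AEStronglyMeasurable
      (fun x : ℝ => ((∑ n ∈ Finset.range M, d n * realLaguerre α n x : ℝ) : ℂ))
      (laguerreMeasure α) :=
    (Complex.continuous_ofReal.comp (by fun_prop)).aestronglyMeasurable
  have hint : ∀ m n, Integrable (fun x => d m * d n * (realLaguerre α m x * realLaguerre α n x))
      (laguerreMeasure α) := fun m n => (integrable_realLaguerre_mul hα m n).const_mul _
  have hL : MemLp (fun x : ℝ => ((∑ n ∈ Finset.range M, d n * realLaguerre α n x : ℝ) : ℂ)) 2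
      (laguerreMeasure α) := by
    rw [memLp_two_iff_integrable_sq_norm hmeas]
    simp only [sq_sum_realLaguerre]
    exact integrable_finsetSum _ fun m _ => integrable_finsetSum _ fun n _ => hint m n
  rw [hL.eLpNorm_eq_integral_rpow_norm two_ne_zero ENNReal.ofNat_ne_top, ENNReal.toReal_ofNat,
    Real.sqrt_eq_rpow, one_div]
  congr 2
  simp only [Real.rpow_two, sq_sum_realLaguerre]
  rw [integral_finsetSum _ fun m _ => integrable_finsetSum _ fun n _ => hint m n]
  refine Finset.sum_congr rfl fun m hm => ?_
  rw [integral_finsetSum _ fun n _ => hint m n]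
  simp only [integral_const_mul, integral_realLaguerre_mul hα, mul_ite, mul_zero,
    Finset.sum_ite_eq, if_pos hm]
  ring

end Orthogonality

/-! ### Fatou and convergence in `L²` -/

lemma eLpNorm_le_of_tendsto {X : Type*} [MeasurableSpace X] {μ : Measure X} {f : ℕ → X → ℂ}
    {g : X → ℂ} {u : ℕ → ENNReal} {C p : ENNReal} (hf : ∀ n, AEStronglyMeasurable (f n) μ)
    (hlim : ∀ x, Tendsto (fun n => f n x) atTop (𝓝 (g x)))
    (hle : ∀ᶠ n in atTop, eLpNorm (f n) p μ ≤ u n) (hu : Tendsto u atTop (𝓝 C)) :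
    eLpNorm g p μ ≤ C := by
  rw [← hu.liminf_eq]
  exact (Lp.eLpNorm_lim_le_liminf_eLpNorm hf g (Eventually.of_forall hlim)).trans
    (liminf_le_liminf hle)

section Convergence

variable {α a b c : ℝ}

/-- The squared norm of the `n`-th term of the Laguerre series. -/
noncomputable def laguerreWeight (α a b c : ℝ) (n : ℕ) : ℝ :=
  twoHOneCoeff α a b c n ^ 2 * (Real.Gamma (α + 1) * (poch (α + 1) n / (n ! : ℝ)))

lemma laguerreWeight_nonneg (hα : -1 < α) (n : ℕ) : 0 ≤ laguerreWeight α a b c n := by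
  have h1 := poch_pos (show 0 < α + 1 by linarith) n
  have h2 := Real.Gamma_pos_of_pos (show 0 < α + 1 by linarith)
  rw [laguerreWeight]
  positivity

/-- A bound for the squared distance of a partial sum from an Abel mean of the Laguerre series. -/
noncomputable def abelBound (α a b c : ℝ) (N : ℕ) (r : ℝ) : ℝ :=
  ∑ n ∈ Finset.range N, (1 - r ^ n) ^ 2 * laguerreWeight α a b c n +
    (∑' n, laguerreWeight α a b c n - ∑ n ∈ Finset.range N, laguerreWeight α a b c n)

lemma sum_sub_sum_laguerre {N M : ℕ} (hNM : N ≤ M) (r x : ℝ) :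
    ∑ n ∈ Finset.range M, ((twoHOneCoeff α a b c n * r ^ n : ℝ) : ℂ) * laguerreL α n x -
      ∑ n ∈ Finset.range N, (twoHOneCoeff α a b c n : ℂ) * laguerreL α n x =
    ((∑ n ∈ Finset.range M, (twoHOneCoeff α a b c n * (r ^ n - if n < N then 1 else 0)) *
      realLaguerre α n x : ℝ) : ℂ) := by
  have h : ∑ n ∈ Finset.range N, (twoHOneCoeff α a b c n : ℂ) * laguerreL α n x =
      ∑ n ∈ Finset.range M, if n < N then (twoHOneCoeff α a b c n : ℂ) * laguerreL α n x else 0 := by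
    rw [← Finset.sum_filter]
    congr 1
    ext n
    simp
    omega
  rw [h, ← Finset.sum_sub_distrib, Complex.ofReal_sum]
  refine Finset.sum_congr rfl fun n _ => ?_
  rw [laguerreL_ofReal]
  split_ifs <;> push_cast <;> ring

/-- By Parseval, indices below `N` contribute `(1 - r^n)²` times the weight; the others contribute
`r^(2n) ≤ 1` times it, hence at most the tail. -/
lemma eLpNorm_partial_abel_sub_le (hα : -1 < α) (hs : Summable (laguerreWeight α a b c))
    {N M : ℕ} (hNM : N ≤ M) {r : ℝ} (hr : 0 ≤ r) (hr1 : r < 1) :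
    eLpNorm (fun x : ℝ =>
      ∑ n ∈ Finset.range M, ((twoHOneCoeff α a b c n * r ^ n : ℝ) : ℂ) * laguerreL α n x -
      ∑ n ∈ Finset.range N, (twoHOneCoeff α a b c n : ℂ) * laguerreL α n x) 2
      (laguerreMeasure α) ≤ ENNReal.ofReal √(abelBound α a b c N r) := by
  simp only [sum_sub_sum_laguerre hNM]
  rw [eLpNorm_sum_realLaguerre hα]
  refine ENNReal.ofReal_le_ofReal (Real.sqrt_le_sqrt ?_)
  have hw := laguerreWeight_nonneg (a := a) (b := b) (c := c) hα
  have e : ∀ n, (twoHOneCoeff α a b c n * (r ^ n - if n < N then 1 else 0)) ^ 2 *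
      (Real.Gamma (α + 1) * (poch (α + 1) n / (n ! : ℝ))) =
      (r ^ n - if n < N then 1 else 0) ^ 2 * laguerreWeight α a b c n := by
    intro n
    rw [laguerreWeight]
    ring
  simp only [e]
  rw [← Finset.sum_range_add_sum_Ico _ hNM, abelBound]
  refine add_le_add (Finset.sum_le_sum fun n hn => ?_) ?_
  · rw [if_pos (Finset.mem_range.1 hn)]
    exact le_of_eq (by ring)
  · have h1 : ∑ n ∈ Finset.Ico N M, (r ^ n - if n < N then 1 else 0) ^ 2 *
        laguerreWeight α a b c n ≤ ∑ n ∈ Finset.Ico N M, laguerreWeight α a b c n := by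
      refine Finset.sum_le_sum fun n hn => ?_
      rw [if_neg (by have := Finset.mem_Ico.1 hn; omega), sub_zero, ← pow_mul]
      exact mul_le_of_le_one_left (hw n) (pow_le_one₀ hr hr1.le)
    have h2 := hs.sum_le_tsum (Finset.range M) fun n _ => hw n
    rw [← Finset.sum_range_add_sum_Ico _ hNM] at h2
    linarith

@[fun_prop]
lemma continuous_laguerreL (n : ℕ) : Continuous fun x : ℝ => laguerreL α n x := by
  unfold laguerreL
  fun_prop

/-- Fatou is applied twice: `M → ∞` for fixed `r`, then `r → 1`. At `r = 1` the first sum in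
`abelBound` vanishes and only the tail of the weights remains. -/
lemma eLpNorm_twoHOne_sub_le (hα : -1 < α) (hc : ∀ m : ℕ, c ≠ -(m : ℝ))
    (hs : Summable (laguerreWeight α a b c)) (N : ℕ) :
    eLpNorm (fun x : ℝ => twoHOne α a b c x -
      ∑ n ∈ Finset.range N, (twoHOneCoeff α a b c n : ℂ) * laguerreL α n x) 2
      (laguerreMeasure α) ≤ ENNReal.ofReal √(abelBound α a b c N 1) := by
  set r : ℕ → ℝ := fun j => 1 - 1 / ((j : ℝ) + 1) with hr
  have hr0 : ∀ j, 0 ≤ r j := fun j => by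
    rw [hr, sub_nonneg, div_le_one (by positivity)]
    linarith [(j.cast_nonneg : (0 : ℝ) ≤ j)]
  have hr1 : ∀ j, r j < 1 := fun j => sub_lt_self _ (by positivity)
  have hrlim : Tendsto r atTop (𝓝 1) := by
    simpa [hr] using tendsto_one_div_add_atTop_nhds_zero_nat.const_sub (1 : ℝ)
  have hpart : ∀ j (x : ℝ), Tendsto (fun M => ∑ n ∈ Finset.range M,
      ((twoHOneCoeff α a b c n * r j ^ n : ℝ) : ℂ) * laguerreL α n x -
      ∑ n ∈ Finset.range N, (twoHOneCoeff α a b c n : ℂ) * laguerreL α n x) atTop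
      (𝓝 (∑' n, ((twoHOneCoeff α a b c n * r j ^ n : ℝ) : ℂ) * laguerreL α n x -
      ∑ n ∈ Finset.range N, (twoHOneCoeff α a b c n : ℂ) * laguerreL α n x)) := fun j x =>
    (hasSum_abel_laguerre hα hc x (hr0 j) (hr1 j)).summable.hasSum.tendsto_sum_nat.sub_const _
  have hmeas : ∀ j M, AEStronglyMeasurable (fun x : ℝ => ∑ n ∈ Finset.range M,
      ((twoHOneCoeff α a b c n * r j ^ n : ℝ) : ℂ) * laguerreL α n x -
      ∑ n ∈ Finset.range N, (twoHOneCoeff α a b c n : ℂ) * laguerreL α n x)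
      (laguerreMeasure α) := fun j M => Continuous.aestronglyMeasurable (by fun_prop)
  have hcont : Continuous (abelBound α a b c N) := by
    unfold abelBound
    fun_prop
  refine eLpNorm_le_of_tendsto (f := fun j (x : ℝ) =>
      ∑' n, ((twoHOneCoeff α a b c n * r j ^ n : ℝ) : ℂ) * laguerreL α n x -
      ∑ n ∈ Finset.range N, (twoHOneCoeff α a b c n : ℂ) * laguerreL α n x)
    (fun j => aestronglyMeasurable_of_tendsto_ae atTop (hmeas j) (Eventually.of_forall (hpart j)))
    (fun x => (tendsto_abel_laguerre hα hc x hr0 hr1 hrlim).sub_const _)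
    (Eventually.of_forall fun j => eLpNorm_le_of_tendsto (hmeas j) (hpart j)
      ((eventually_ge_atTop N).mono fun M hM =>
        eLpNorm_partial_abel_sub_le hα hs hM (hr0 j) (hr1 j)) tendsto_const_nhds) ?_
  exact ENNReal.tendsto_ofReal (((hcont.tendsto 1).comp hrlim).sqrt)

lemma isTwoHOne_twoHOne (hα : -1 < α) (hc : ∀ m : ℕ, c ≠ -(m : ℝ))
    (hs : Summable (laguerreWeight α a b c)) :
    IsTwoHOne α a b c fun x : ℝ => twoHOne α a b c x := by
  have hle := eLpNorm_twoHOne_sub_le hα hc hs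
  constructor
  · refine ⟨((differentiable_twoHOne hα hc).continuous.comp
      Complex.continuous_ofReal).aestronglyMeasurable, ?_⟩
    -- The empty partial sum gives membership in `L²`.
    have h := hle 0
    simp only [Finset.range_zero, Finset.sum_empty, sub_zero] at h
    exact h.trans_lt ENNReal.ofReal_lt_top
  · refine tendsto_of_tendsto_of_tendsto_of_le_of_le tendsto_const_nhds ?_ (fun _ => zero_le) hle
    have h1 : Tendsto (fun N => abelBound α a b c N 1) atTop (𝓝 0) := by
      have h2 := hs.hasSum.tendsto_sum_nat.const_sub (∑' n, laguerreWeight α a b c n)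
      rw [sub_self] at h2
      refine h2.congr fun N => ?_
      simp [abelBound]
    simpa using ENNReal.tendsto_ofReal h1.sqrt

lemma IsTwoHOne.ae_eq {f g : ℝ → ℂ} (hf : IsTwoHOne α a b c f) (hg : IsTwoHOne α a b c g) :
    f =ᵐ[laguerreMeasure α] g := by
  have hlim := hf.2.add hg.2
  rw [add_zero] at hlim
  have hP : ∀ N, AEStronglyMeasurable (fun x : ℝ =>
      ∑ n ∈ Finset.range N, (twoHOneCoeff α a b c n : ℂ) * laguerreL α n x)
      (laguerreMeasure α) := fun N => Continuous.aestronglyMeasurable (by fun_prop)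
  have h0 : eLpNorm (f - g) 2 (laguerreMeasure α) = 0 := by
    refine le_antisymm (ge_of_tendsto' hlim fun N => ?_) zero_le
    have h := eLpNorm_sub_le (p := 2) (hf.1.1.sub (hP N)) (hg.1.1.sub (hP N)) one_le_two
    refine le_trans (le_of_eq ?_) h
    congr 1
    ext x
    simp
  rw [eLpNorm_eq_zero_iff (hf.1.1.sub hg.1.1) two_ne_zero] at h0
  filter_upwards [h0] with x hx
  exact sub_eq_zero.1 hx

end Convergence

theorem mainTheorem3 (α a b c : ℝ) (hα : -1 < α)
    (ha : ∀ m : ℕ, a ≠ -(m : ℝ)) (hb : ∀ m : ℕ, b ≠ -(m : ℝ)) (hc : ∀ m : ℕ, c ≠ -(m : ℝ))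
    (hconv : 0 < c - a - b + (α + 1) / 2) :
    -- the Laguerre series converges in the weighted Hilbert space
    (∃ f : ℝ → ℂ, IsTwoHOne α a b c f) ∧
    -- the series `₂F₁(a+ν, b+ν; c+ν; -1)` diverges for all sufficiently large `ν`
    (∀ᶠ ν : ℕ in atTop, ¬ ∃ s : ℝ,
      Tendsto (fun N : ℕ => ∑ n ∈ Finset.range N, gaussTerm (a + ν) (b + ν) (c + ν) (-1) n)
        atTop (𝓝 s)) ∧
    -- for every `ν` the two replacing series at `1/2` converge, and both give the value at `-1`
    -- of the analytic continuation of `₂F₁(a+ν, b+ν; c+ν; ·)`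
    (∀ ν : ℕ,
      Summable (gaussTerm (a + ν) (c - b) (c + ν) (1 / 2)) ∧
      Summable (gaussTerm (c - a) (b + ν) (c + ν) (1 / 2)) ∧
      IsContinuedGaussAtNegOne (a + ν) (b + ν) (c + ν)
        ((2 : ℝ) ^ (-a - ν) * ₂F₁ (a + ν) (c - b) (c + ν) (1 / 2 : ℝ)) ∧
      IsContinuedGaussAtNegOne (a + ν) (b + ν) (c + ν)
        ((2 : ℝ) ^ (-b - ν) * ₂F₁ (c - a) (b + ν) (c + ν) (1 / 2 : ℝ))) ∧
    -- both power series converge in the whole plane to one entire function `F`, and the function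
    -- defined by the Laguerre series is `F`
    (∃ F : ℂ → ℂ,
      AnalyticOnNhd ℂ F Set.univ ∧
      (∀ z : ℂ, Summable (powerTermFst α a b c z) ∧
        F z = (((2 : ℝ) ^ (-a) : ℝ) : ℂ) * ∑' ν : ℕ, powerTermFst α a b c z ν) ∧
      (∀ z : ℂ, Summable (powerTermSnd α a b c z) ∧
        F z = (((2 : ℝ) ^ (-b) : ℝ) : ℂ) * ∑' ν : ℕ, powerTermSnd α a b c z ν) ∧
      (∀ f : ℝ → ℂ, IsTwoHOne α a b c f →
        ∀ᵐ x ∂(volume.restrict (Set.Ici (0 : ℝ))), f x = F (x : ℂ))) := by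

  have hs : Summable (laguerreWeight α a b c) :=
    ((summable_twoHOneCoeff_sq hα ha hb hc hconv).mul_left (Real.Gamma (α + 1))).congr fun n => by
      rw [laguerreWeight]
      ring
  have hsum := isTwoHOne_twoHOne hα hc hs
  refine ⟨⟨_, hsum⟩, eventually_not_tendsto_sum_gaussTerm a b c, fun ν => ?_,
    twoHOne α a b c, fun z _ => (differentiable_twoHOne hα hc).analyticAt z, fun z => ?_,
    fun z => ?_, fun f hf => ae_laguerreMeasure_le (hf.ae_eq hsum)⟩
  · have hcν := add_natCast_ne_neg_natCast hc ν
    have h1 := pfaffTransform_neg_one (a + ν) (b + ν) (c + ν)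
    have h2 := two_rpow_mul_hypergeometric_comm (a + ν) (b + ν) hcν
    have h3 := h1
    -- One continuation, `pfaffTransform`, serves both claims; only the expression for its value at
    -- `-1` changes.
    rw [h2] at h3
    simp only [add_sub_add_right_eq_sub, neg_add, ← sub_eq_add_neg] at h1 h3
    have hhalf : |(1 / 2 : ℝ)| < 1 := by rw [abs_of_pos] <;> norm_num
    exact ⟨summable_gaussTerm _ _ hcν hhalf, summable_gaussTerm _ _ hcν hhalf,
      isContinuedGaussAtNegOne_of_pfaffTransform hcν h1,
      isContinuedGaussAtNegOne_of_pfaffTransform hcν h3⟩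
  · have h := hasSum_powerTermFst (a := a) (b := b) hα hc z
    exact ⟨h.summable, by rw [h.tsum_eq, twoHOne]⟩
  · have h := (hasSum_powerTermFst (a := a) (b := b) hα hc z).mul_left (((2 : ℝ) ^ (-a) : ℝ) : ℂ)
    simp only [two_rpow_mul_powerTermFst hc] at h
    have h2 : (((2 : ℝ) ^ (-b) : ℝ) : ℂ) ≠ 0 := by
      exact_mod_cast (Real.rpow_pos_of_pos two_pos _).ne'
    exact ⟨(summable_mul_left_iff h2).1 h.summable, by rw [← tsum_mul_left, h.tsum_eq, twoHOne]⟩
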